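/- Let $\mathfrak U=\langle S;P_1,\ldots,P_r;L_1,\ldots,L_r\rangle$ consist of a countable set $S\subseteq[0,\infty)$, finitely many relation symbols $P_i$ of arities $k_i\ge 1$, and subgroups $L_i\le \mathrm{Sym}(k_i)$. A $\mathfrak U$-structure is a set $X$ (possibly empty) with relations $P_i\subseteq X^{k_i}$ and binary relations $E_s$ ($s\in S$) such that: each $P_i$ is $L_i$-symmetric, i.e. $P_i(x_{\vartheta(1)},\ldots,x_{\vartheta(k_i)})\Leftrightarrow P_i(x_1,\ldots,x_{k_i})$ for all $\vartheta\in L_i$; $P_i(x_1,\ldots,x_{k_i})$ implies that $x_1,\ldots,x_{k_i}$ are pairwise distinct; each $E_s$ is an equivalence relation; $E_s\subseteq E_t$ whenever $s<t$; and, if $S\neq\emptyset$, for all $x\ne y$ in $X$ there is a largest $s\in S$ with $\neg\, xE_sy$. (If $S\subseteq(0,\infty)$ is non-empty, this largest $s$ is an ultrametric distance $d(x,y)$ and $xE_sy\Leftrightarrow d(x,y)<s$; if $S=\emptyset$, a $\mathfrak U$-structure is just a relational structure.) The randomised ultrametric space $\mathbf U$ of $\mathfrak U$ is the Fraïssé limit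 of the class of finite $\mathfrak U$-structures, i.e. the countable structure, unique up to isomorphism, in which every isomorphism between finite substructures extends to an automorphism and whose finite substructures are, up to isomorphism, exactly the finite $\mathfrak U$-structures. For a group $\Gamma$ let $\mathrm{Rep}(\Gamma,\mathbf U)$ be the space of homomorphisms $\pi:\Gamma\to\mathrm{Aut}(\mathbf U)$, topologised as a subspace of $\mathrm{Aut}(\mathbf U)^\Gamma$, where $\mathrm{Aut}(\mathbf U)$ has the topology of pointwise convergence on the discrete set $\mathbf U$. A representation $\pi$ is generic if its conjugacy class $\{g\pi g^{-1}: g\in\mathrm{Aut}(\mathbf U)\}$ is comeagre in $\mathrm{Rep}(\Gamma,\mathbf U)$. **Theorem.** Let $\Gamma$ be a finitely generated abelian group and $\mathbf U$ the randomised ultrametric space of a tuple $\mathfrak U$ as above. Then $\mathrm{Rep}(\Gamma,\mathbf U)$ has a generic representation. Moreover, for every generic representation $\pi$ of $\Gamma$ on $\mathbf U$, every $\Gamma$-orbit on $\mathbf U$ under $\pi$ is finite. -/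

import Mathlib

open scoped NNReal

namespace RandUltra

open FirstOrder FirstOrder.Language

/-! ### Tuples `𝔘 = ⟨S; P₁, …, P_r; L₁, …, L_r⟩` and their languages -/

/-- A tuple `⟨S; P₁, …, P_r; L₁, …, L_r⟩`: a countable set `S` of non-negative reals, finitely many
relation symbols `P i` of positive arity, and for each of them a group `L i` of permutations of its
argument places. -/
structure Tuple where
  /-- The set of distances. -/
  S : Set ℝ≥0
  countable_S : S.Countable
  /-- The number of relation symbols. -/
  r : ℕ
  /-- The arities of the relation symbols. -/
  arity : Fin r → ℕ
  arity_pos : ∀ i, 0 < arity i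
  /-- The groups of symmetries that are imposed on the relations. -/
  sym : ∀ i, Subgroup (Equiv.Perm (Fin (arity i)))

/-- The relation symbols of the language of `𝔘`: binary symbols `E s` for `s ∈ S`, and the
symbols `P i`. -/
inductive Tuple.Rel (𝔘 : Tuple) : ℕ → Type
  | E (s : 𝔘.S) : Tuple.Rel 𝔘 2
  | P (i : Fin 𝔘.r) : Tuple.Rel 𝔘 (𝔘.arity i)

/-- The relational language `{E_s : s ∈ S} ∪ {P₁, …, P_r}` of `𝔘`. -/
def Tuple.lang (𝔘 : Tuple) : FirstOrder.Language.{0, 0} where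
  Functions := fun _ => Empty
  Relations := 𝔘.Rel

instance (𝔘 : Tuple) : IsRelational 𝔘.lang := fun _ => inferInstanceAs (IsEmpty Empty)

instance (𝔘 : Tuple) : Countable (Σ l, 𝔘.lang.Functions l) :=
  inferInstanceAs (Countable (Σ _ : ℕ, Empty))

section Structures

universe w

variable (𝔘 : Tuple) (X : Type w) [𝔘.lang.Structure X]

/-- The interpretation of `E_s` in `X`. -/
def Tuple.relE (s : 𝔘.S) (x y : X) : Prop :=
  Structure.RelMap (L := 𝔘.lang) (Tuple.Rel.E s) ![x, y]

/-- The interpretation of `P_i` in `X`. -/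
def Tuple.relP (i : Fin 𝔘.r) (x : Fin (𝔘.arity i) → X) : Prop :=
  Structure.RelMap (L := 𝔘.lang) (Tuple.Rel.P i) x

/-- `𝔘`-structures. When `S` is empty, there is no ultrametric and the last condition is void, so
that `𝔘`-structures are then just relational structures. -/
structure Tuple.IsUStructure : Prop where
  symm_P : ∀ i, ∀ ϑ ∈ 𝔘.sym i, ∀ x : Fin (𝔘.arity i) → X,
    𝔘.relP X i (x ∘ ϑ) ↔ 𝔘.relP X i x
  distinct_P : ∀ i, ∀ x : Fin (𝔘.arity i) → X, 𝔘.relP X i x → Function.Injective x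
  equivalence_E : ∀ s : 𝔘.S, Equivalence (𝔘.relE X s)
  mono_E : ∀ s t : 𝔘.S, s < t → ∀ x y : X, 𝔘.relE X s x y → 𝔘.relE X t x y
  exists_max : 𝔘.S.Nonempty → ∀ x y : X, x ≠ y →
    ∃ s : 𝔘.S, IsGreatest {t : 𝔘.S | ¬ 𝔘.relE X t x y} s

/-- The class of all finite `𝔘`-structures (the empty one included). -/
def Tuple.finiteStructures : Set (CategoryTheory.Bundled.{w} 𝔘.lang.Structure) :=
  {M | Finite M ∧ 𝔘.IsUStructure M}

/-- The countable structure `X` is the randomised ultrametric space of `𝔘`, i.e. the Fraïssé limit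
of the class of finite `𝔘`-structures: it is ultrahomogeneous and its age consists of the finite
`𝔘`-structures. This determines `X` up to isomorphism. -/
def Tuple.IsRandomisedUltrametricSpace [Countable X] : Prop :=
  IsFraisseLimit (𝔘.finiteStructures : Set (CategoryTheory.Bundled.{w} 𝔘.lang.Structure)) X

end Structures

/-! ### Automorphism groups and spaces of representations -/

section Representations

universe u v w z

variable (L : FirstOrder.Language.{u, v}) (M : Type w) [L.Structure M]

/-- The automorphisms of `M`. -/
abbrev Aut : Type w := M ≃[L] M

/-- Automorphisms form a group under composition. -/
instance Aut.instGroup : Group (Aut L M) where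
  mul g h := g.comp h
  one := FirstOrder.Language.Equiv.refl L M
  inv g := g.symm
  mul_assoc _ _ _ := rfl
  one_mul _ := rfl
  mul_one _ := rfl
  inv_mul_cancel g := by
    ext x
    exact g.toEquiv.symm_apply_apply x

/-- The topology of pointwise convergence on the automorphism group, `M` being discrete. -/
instance Aut.instTopologicalSpace : TopologicalSpace (Aut L M) :=
  TopologicalSpace.induced (fun g : Aut L M => (g : M → M))
    (@Pi.topologicalSpace M (fun _ => M) (fun _ => ⊥))

variable (Γ : Type z) [Group Γ]

/-- The representations of `Γ` by automorphisms of `M`. -/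
abbrev Rep : Type (max z w) := Γ →* Aut L M

/-- The topology on the space of representations as a subspace of the power `Aut(M)^Γ` (one may
replace `Γ` by any generating set). -/
instance Rep.instTopologicalSpace : TopologicalSpace (Rep L M Γ) :=
  TopologicalSpace.induced (fun π : Rep L M Γ => (π : Γ → Aut L M)) inferInstance

variable {L M Γ}

/-- Two representations are conjugate if `g γ^π g⁻¹ = γ^θ` for some automorphism `g` and
all `γ`. -/
def Rep.IsConjugate (π θ : Rep L M Γ) : Prop :=
  ∃ g : Aut L M, ∀ γ : Γ, g * π γ * g⁻¹ = θ γ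

/-- A representation is generic if its conjugacy class is comeagre in the space of
representations. -/
def Rep.IsGeneric (π : Rep L M Γ) : Prop :=
  {θ : Rep L M Γ | π.IsConjugate θ} ∈ residual (Rep L M Γ)

/-- The orbit of the point `x` of `M` under the action `π`. -/
def Rep.orbit (π : Rep L M Γ) (x : M) : Set M :=
  Set.range fun γ : Γ => π γ x

end Representations

end RandUltra

/-! The space of representations is a closed subspace of a countable power of a countable discrete
space, hence a Baire space. Two properties are shown to be comeagre in it: all orbits are finite
(`FiniteOrbits`), and every action on a finite substructure is realised over any invariant part on
which it already agrees with the representation (`Saturated`). A back-and-forth argument that adds a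
whole finite orbit at each step shows that any two representations with both properties are
conjugate (`Rep.isConjugate_of_saturated`). Hence such a representation exists and is generic. The
class of an arbitrary generic representation meets the comeagre set with finite orbits, and
finiteness of orbits is invariant under conjugation.

Density rests on three facts about actions on finite substructures. They extend to one further
point, hence to all of `U` (`IsPartialRep.exists_extension`, `IsPartialRep.exists_rep`), and they
amalgamate over a common invariant part (`IsPartialRep.exists_amalgam`); both come from free
amalgamation. They also approximate every representation (`Rep.exists_isPartialRep`), and it is here
that `Γ` has to be abelian. One passes to the quotient of `U` by the `m`-th powers of `Γ`: each
orbit becomes finite, because `Γ/Γ^m` is finite, and for suitable `m` a given finite set with its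
distances and relations survives. Such an `m` exists because a point outside a subgroup of a
finitely generated abelian group can be separated from it modulo `m`-th powers, applied to
stabilisers and, for the relations `P i`, to a subgroup of a finite power of `Γ`. -/

namespace RandUltra

open FirstOrder FirstOrder.Language

universe w w'

/-! ### Partial embeddings of `𝔘`-structures -/

section PartialEmbeddings

variable {𝔘 : Tuple}

/-- The map `f` restricts to an embedding of the substructure with underlying set `A`. -/
structure Tuple.IsEmbOn (𝔘 : Tuple) {X : Type w} {Y : Type w'} [𝔘.lang.Structure X]
    [𝔘.lang.Structure Y] (A : Set X) (f : X → Y) : Prop where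
  injOn : Set.InjOn f A
  relE_iff : ∀ s, ∀ x ∈ A, ∀ y ∈ A, 𝔘.relE Y s (f x) (f y) ↔ 𝔘.relE X s x y
  relP_iff : ∀ i, ∀ x : Fin (𝔘.arity i) → X, (∀ j, x j ∈ A) →
    (𝔘.relP Y i (f ∘ x) ↔ 𝔘.relP X i x)

lemma Tuple.IsEmbOn.mono {X : Type w} {Y : Type w'} [𝔘.lang.Structure X]
    [𝔘.lang.Structure Y] {A B : Set X} {f : X → Y} (h : 𝔘.IsEmbOn B f) (hAB : A ⊆ B) :
    𝔘.IsEmbOn A f :=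
  ⟨h.injOn.mono hAB, fun s x hx y hy => h.relE_iff s x (hAB hx) y (hAB hy),
    fun i x hx => h.relP_iff i x fun j => hAB (hx j)⟩

lemma Tuple.IsEmbOn.comp {X Y Z : Type*} [𝔘.lang.Structure X]
    [𝔘.lang.Structure Y] [𝔘.lang.Structure Z] {A : Set X} {B : Set Y} {f : X → Y} {g : Y → Z}
    (hg : 𝔘.IsEmbOn B g) (hf : 𝔘.IsEmbOn A f) (hAB : Set.MapsTo f A B) :
    𝔘.IsEmbOn A (g ∘ f) := by
  refine ⟨hg.injOn.comp hf.injOn hAB, fun s x hx y hy => ?_, fun i x hx => ?_⟩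
  · exact (hg.relE_iff s _ (hAB hx) _ (hAB hy)).trans (hf.relE_iff s x hx y hy)
  · exact (hg.relP_iff i (f ∘ x) fun j => hAB (hx j)).trans (hf.relP_iff i x hx)

lemma Tuple.IsEmbOn.of_leftInvOn {X Y : Type*} [𝔘.lang.Structure X]
    [𝔘.lang.Structure Y] {A : Set X} {B : Set Y} {f : X → Y} {g : Y → X}
    (hf : 𝔘.IsEmbOn A f) (hg : Set.MapsTo g B A) (hfg : Set.LeftInvOn f g B) :
    𝔘.IsEmbOn B g := by
  refine ⟨hfg.injOn, fun s x hx y hy => ?_, fun i x hx => ?_⟩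
  · rw [← hf.relE_iff s _ (hg hx) _ (hg hy), hfg hx, hfg hy]
  · rw [← hf.relP_iff i (g ∘ x) fun j => hg (hx j)]
    have : f ∘ g ∘ x = x := funext fun j => hfg (hx j)
    rw [this]

lemma Tuple.isEmbOn_aut {X : Type w} [𝔘.lang.Structure X] (A : Set X) (h : Aut 𝔘.lang X) :
    𝔘.IsEmbOn A h := by
  refine ⟨h.injective.injOn, fun s x _ y _ => ?_, fun i x _ => ?_⟩
  · have := h.map_rel (Tuple.Rel.E s : 𝔘.lang.Relations 2) ![x, y]
    have e : (h ∘ ![x, y]) = ![h x, h y] := by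
      funext j; fin_cases j <;> rfl
    rw [e] at this
    exact this
  · exact h.map_rel (Tuple.Rel.P i : 𝔘.lang.Relations _) x

lemma Aut.relE_iff {X : Type w} [𝔘.lang.Structure X] (h : Aut 𝔘.lang X) (s : 𝔘.S) (x y : X) :
    𝔘.relE X s (h x) (h y) ↔ 𝔘.relE X s x y :=
  (𝔘.isEmbOn_aut Set.univ h).relE_iff s x trivial y trivial

lemma Aut.relP_iff {X : Type w} [𝔘.lang.Structure X] (h : Aut 𝔘.lang X) (i : Fin 𝔘.r)
    (x : Fin (𝔘.arity i) → X) : 𝔘.relP X i (h ∘ x) ↔ 𝔘.relP X i x :=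
  (𝔘.isEmbOn_aut Set.univ h).relP_iff i x fun _ => trivial

/-- A partial embedding, as an embedding of first-order structures. -/
noncomputable def Tuple.IsEmbOn.toEmbedding {X : Type w} {Y : Type w'} [𝔘.lang.Structure X]
    [𝔘.lang.Structure Y] {A : Set X} {f : X → Y} (h : 𝔘.IsEmbOn A f)
    (S : 𝔘.lang.Substructure X) (hS : (S : Set X) ⊆ A) : S ↪[𝔘.lang] Y where
  toFun x := f x
  inj' x y hxy := Subtype.ext (h.injOn (hS x.2) (hS y.2) hxy)
  map_fun' := fun {n} F => (inferInstance : IsEmpty (𝔘.lang.Functions n)).elim F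
  map_rel' := by
    intro n R x
    cases R with
    | E s =>
      have e : (fun x : S => f x) ∘ x = ![f (x 0), f (x 1)] := by
        funext j; fin_cases j <;> rfl
      have e' : (fun j => (x j : X)) = ![(x 0 : X), (x 1 : X)] := by
        funext j; fin_cases j <;> rfl
      have := h.relE_iff s _ (hS (x 0).2) _ (hS (x 1).2)
      unfold Tuple.relE at this
      rw [← e, ← e'] at this
      exact this
    | P i => exact h.relP_iff i (fun j => (x j : X)) fun j => hS (x j).2

lemma Tuple.isEmbOn_of_embedding {X : Type w} {Y : Type w'} [𝔘.lang.Structure X]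
    [𝔘.lang.Structure Y] (S : 𝔘.lang.Substructure X) (g : S ↪[𝔘.lang] Y) (f : X → Y)
    (hf : ∀ x : S, f x = g x) : 𝔘.IsEmbOn (S : Set X) f := by
  refine ⟨fun x hx y hy hxy => ?_, fun s x hx y hy => ?_, fun i x hx => ?_⟩
  · rw [hf ⟨x, hx⟩, hf ⟨y, hy⟩] at hxy
    exact congrArg Subtype.val (g.injective hxy)
  · have := g.map_rel (Tuple.Rel.E s : 𝔘.lang.Relations 2) ![⟨x, hx⟩, ⟨y, hy⟩]
    have e : g ∘ ![(⟨x, hx⟩ : S), ⟨y, hy⟩] = ![f x, f y] := by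
      funext j
      fin_cases j
      · exact (hf ⟨x, hx⟩).symm
      · exact (hf ⟨y, hy⟩).symm
    have e' : (fun j => ((![(⟨x, hx⟩ : S), ⟨y, hy⟩] j : S) : X)) = ![x, y] := by
      funext j; fin_cases j <;> rfl
    rw [e] at this
    unfold Tuple.relE
    rw [this, ← e']
    rfl
  · have := g.map_rel (Tuple.Rel.P i : 𝔘.lang.Relations _) fun j => (⟨x j, hx j⟩ : S)
    have e : (g ∘ fun j => (⟨x j, hx j⟩ : S)) = f ∘ x := by
      funext j
      exact (hf ⟨x j, hx j⟩).symm
    rw [e] at this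
    exact this

lemma Tuple.relE_substructure (𝔘 : Tuple) {X : Type w} [𝔘.lang.Structure X]
    (S : 𝔘.lang.Substructure X) (s : 𝔘.S) (x y : S) : 𝔘.relE S s x y ↔ 𝔘.relE X s x y := by
  have h := 𝔘.isEmbOn_of_embedding S (Embedding.refl 𝔘.lang S) (Y := S)
    (fun z => by classical exact if hz : z ∈ S then ⟨z, hz⟩ else x) (by intro z; simp)
  simpa using h.relE_iff s x x.2 y y.2

/-- Being a `𝔘`-structure passes to substructures. -/
lemma Tuple.IsUStructure.substructure {X : Type w} [𝔘.lang.Structure X] (hX : 𝔘.IsUStructure X)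
    (S : 𝔘.lang.Substructure X) : 𝔘.IsUStructure S := by
  have E := 𝔘.relE_substructure S
  have P : ∀ i (x : Fin (𝔘.arity i) → S), 𝔘.relP S i x ↔ 𝔘.relP X i (fun j => (x j : X)) :=
    fun _ _ => Iff.rfl
  refine ⟨fun i ϑ hϑ x => ?_, fun i x hx => ?_, fun s => ⟨fun x => ?_, fun {x y} h => ?_,
    fun {x y z} h h' => ?_⟩, fun s t hst x y h => ?_, fun hS x y hxy => ?_⟩
  · rw [P, P]
    exact hX.symm_P i ϑ hϑ fun j => (x j : X)
  · exact fun a b hab => hX.distinct_P i _ ((P i x).1 hx) (congrArg Subtype.val hab)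
  · exact (E _ _ _).2 ((hX.equivalence_E s).refl _)
  · exact (E _ _ _).2 ((hX.equivalence_E s).symm ((E _ _ _).1 h))
  · exact (E _ _ _).2 ((hX.equivalence_E s).trans ((E _ _ _).1 h) ((E _ _ _).1 h'))
  · exact (E _ _ _).2 (hX.mono_E s t hst _ _ ((E _ _ _).1 h))
  · simp only [E]
    exact hX.exists_max hS x y fun h => hxy (Subtype.ext h)

/-- Being a `𝔘`-structure is a condition on the finite substructures. -/
lemma Tuple.IsUStructure.of_finite_substructures {X : Type w} [𝔘.lang.Structure X]
    (h : ∀ S : 𝔘.lang.Substructure X, (S : Set X).Finite → 𝔘.IsUStructure S) :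
    𝔘.IsUStructure X := by
  have key : ∀ A : Set X, A.Finite → ∃ S : 𝔘.lang.Substructure X, A ⊆ S ∧ 𝔘.IsUStructure S := by
    intro A hA
    refine ⟨Substructure.closure _ A, Substructure.subset_closure, h _ ?_⟩
    rwa [Substructure.closure_eq_of_isRelational]
  have E := 𝔘.relE_substructure (X := X)
  refine ⟨fun i ϑ hϑ x => ?_, fun i x hx => ?_, fun s => ⟨fun x => ?_, fun {x y} h => ?_,
    fun {x y z} h h' => ?_⟩, fun s t hst x y h => ?_, fun hS x y hxy => ?_⟩
  · obtain ⟨S, hS, hU⟩ := key _ (Set.finite_range x)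
    exact hU.symm_P i ϑ hϑ fun j => ⟨x j, hS ⟨j, rfl⟩⟩
  · obtain ⟨S, hS, hU⟩ := key _ (Set.finite_range x)
    intro a b hab
    exact hU.distinct_P i (fun j => ⟨x j, hS ⟨j, rfl⟩⟩) hx (Subtype.ext hab)
  · obtain ⟨S, hS, hU⟩ := key {x} (Set.toFinite _)
    have hx : x ∈ S := hS (by simp)
    exact (E S s ⟨x, hx⟩ ⟨x, hx⟩).1 ((hU.equivalence_E s).refl _)
  · obtain ⟨S, hS, hU⟩ := key {x, y} (Set.toFinite _)
    have hx : x ∈ S := hS (by simp)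
    have hy : y ∈ S := hS (by simp)
    exact (E S s ⟨y, hy⟩ ⟨x, hx⟩).1
      ((hU.equivalence_E s).symm ((E S s ⟨x, hx⟩ ⟨y, hy⟩).2 h))
  · obtain ⟨S, hS, hU⟩ := key {x, y, z} (Set.toFinite _)
    have hx : x ∈ S := hS (by simp)
    have hy : y ∈ S := hS (by simp)
    have hz : z ∈ S := hS (by simp)
    exact (E S s ⟨x, hx⟩ ⟨z, hz⟩).1
      ((hU.equivalence_E s).trans ((E S s ⟨x, hx⟩ ⟨y, hy⟩).2 h) ((E S s ⟨y, hy⟩ ⟨z, hz⟩).2 h'))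
  · obtain ⟨S, hS, hU⟩ := key {x, y} (Set.toFinite _)
    have hx : x ∈ S := hS (by simp)
    have hy : y ∈ S := hS (by simp)
    exact (E S t ⟨x, hx⟩ ⟨y, hy⟩).1 (hU.mono_E s t hst _ _ ((E S s ⟨x, hx⟩ ⟨y, hy⟩).2 h))
  · obtain ⟨S, hS', hU⟩ := key {x, y} (Set.toFinite _)
    have hx : x ∈ S := hS' (by simp)
    have hy : y ∈ S := hS' (by simp)
    simpa only [E] using hU.exists_max hS ⟨x, hx⟩ ⟨y, hy⟩ fun h => hxy (congrArg Subtype.val h)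

end PartialEmbeddings

/-! ### Homogeneity and universality of the randomised ultrametric space -/

section Limit

variable {𝔘 : Tuple} {U : Type w} [𝔘.lang.Structure U] [Countable U]

lemma Tuple.IsRandomisedUltrametricSpace.isUStructure (hU : 𝔘.IsRandomisedUltrametricSpace U) :
    𝔘.IsUStructure U := by
  refine .of_finite_substructures fun S hS => ?_
  have : CategoryTheory.Bundled.mk S (inferInstance : 𝔘.lang.Structure S) ∈ 𝔘.lang.age U :=
    age.fg_substructure (Substructure.fg_iff_finite.2 hS)
  rw [hU.age] at this
  exact this.2

/-- Partial isomorphisms between finite subsets extend to automorphisms. -/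
lemma Tuple.IsRandomisedUltrametricSpace.exists_aut (hU : 𝔘.IsRandomisedUltrametricSpace U)
    {A : Set U} (hA : A.Finite) {f : U → U} (hf : 𝔘.IsEmbOn A f) :
    ∃ g : Aut 𝔘.lang U, ∀ a ∈ A, g a = f a := by
  have hcl : (Substructure.closure 𝔘.lang A : Set U) = A :=
    Substructure.closure_eq_of_isRelational _ _
  obtain ⟨g, hg⟩ := hU.ultrahomogeneous _ (Substructure.fg_closure hA)
    (hf.toEmbedding (Substructure.closure 𝔘.lang A) hcl.le)
  refine ⟨g, fun a ha => ?_⟩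
  have := DFunLike.congr_fun hg ⟨a, Substructure.subset_closure ha⟩
  exact this.symm

/-- Finite `𝔘`-structures embed over any finite common part. -/
lemma Tuple.IsRandomisedUltrametricSpace.exists_isEmbOn (hU : 𝔘.IsRandomisedUltrametricSpace U)
    {X : Type w} [𝔘.lang.Structure X] (hX : 𝔘.IsUStructure X) {Z : Set X} (hZ : Z.Finite)
    {A : Set U} (hA : A.Finite) {j : U → X} (hj : 𝔘.IsEmbOn A j) (hjZ : Set.MapsTo j A Z) :
    ∃ e : X → U, 𝔘.IsEmbOn Z e ∧ ∀ a ∈ A, e (j a) = a := by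
  classical
  rcases isEmpty_or_nonempty X with hXe | ⟨⟨x₀⟩⟩
  · exact ⟨isEmptyElim, ⟨isEmptyElim, fun _ => isEmptyElim,
      fun i x _ => isEmptyElim (x ⟨0, 𝔘.arity_pos i⟩)⟩, fun a => isEmptyElim (j a)⟩
  -- The extra point makes `S` non-empty, so that `U` has an element `e₀` to serve as a default
  -- value.
  set S := Substructure.closure 𝔘.lang (insert x₀ Z) with hS
  have hcl : (S : Set X) = insert x₀ Z := Substructure.closure_eq_of_isRelational _ _
  have hm : CategoryTheory.Bundled.mk S (inferInstanceAs (𝔘.lang.Structure S)) ∈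
      (𝔘.finiteStructures : Set (CategoryTheory.Bundled.{w} _)) := by
    refine ⟨?_, hX.substructure _⟩
    change Finite (S : Set X)
    rw [hcl]
    exact hZ.insert x₀
  rw [← hU.age] at hm
  obtain ⟨e⟩ := hm.2
  have e₀ : U := e ⟨x₀, Substructure.subset_closure (Set.mem_insert _ _)⟩
  let f : X → U := fun x => if hx : x ∈ S then e ⟨x, hx⟩ else e₀
  have hf : 𝔘.IsEmbOn Z f := by
    have := 𝔘.isEmbOn_of_embedding S e f (fun x => dif_pos x.2)
    rw [hcl] at this
    exact this.mono (Set.subset_insert _ _)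
  obtain ⟨g, hg⟩ := hU.exists_aut hA (hf.comp hj hjZ)
  refine ⟨(g⁻¹ : Aut 𝔘.lang U) ∘ f, (𝔘.isEmbOn_aut Set.univ g⁻¹).comp hf fun _ _ => trivial,
    fun a ha => ?_⟩
  have : f (j a) = g a := (hg a ha).symm
  change g.symm (f (j a)) = a
  rw [this]
  exact g.toEquiv.symm_apply_apply a

end Limit

/-! ### Distances -/

section Distances

variable {𝔘 : Tuple} {X : Type w} [𝔘.lang.Structure X]

/-- The points `x` and `y` have distance at most `t`. -/
def Tuple.relLe (𝔘 : Tuple) (X : Type w) [𝔘.lang.Structure X] (t : 𝔘.S) (x y : X) : Prop :=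
  ∀ s, t < s → 𝔘.relE X s x y

lemma Tuple.IsUStructure.equivalence_relLe (hX : 𝔘.IsUStructure X) (t : 𝔘.S) :
    Equivalence (𝔘.relLe X t) :=
  ⟨fun _ s _ => (hX.equivalence_E s).refl _, fun h s hs => (hX.equivalence_E s).symm (h s hs),
    fun h h' s hs => (hX.equivalence_E s).trans (h s hs) (h' s hs)⟩

lemma Tuple.relLe_mono {t t' : 𝔘.S} (htt' : t ≤ t') {x y : X} (h : 𝔘.relLe X t x y) :
    𝔘.relLe X t' x y :=
  fun s hs => h s (htt'.trans_lt hs)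

lemma Aut.relLe_iff (h : Aut 𝔘.lang X) (t : 𝔘.S) (x y : X) :
    𝔘.relLe X t (h x) (h y) ↔ 𝔘.relLe X t x y :=
  forall_congr' fun s => imp_congr_right fun _ => h.relE_iff s x y

lemma Tuple.IsUStructure.exists_dist (hX : 𝔘.IsUStructure X) (hS : 𝔘.S.Nonempty) {x y : X}
    (hxy : x ≠ y) : ∃ d : 𝔘.S, ∀ s, 𝔘.relE X s x y ↔ d < s := by
  obtain ⟨d, hd, hmax⟩ := hX.exists_max hS x y hxy
  refine ⟨d, fun s => ⟨fun h => ?_, fun h => ?_⟩⟩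
  · by_contra hs
    rcases (not_lt.1 hs).lt_or_eq with h' | rfl
    · exact hd (hX.mono_E s d h' x y h)
    · exact hd h
  · by_contra hs
    exact absurd (hmax hs) (not_le.2 h)

/-- The finite set `D` contains the distances between the points of `A`, and it is empty only if
there are no distances at all. -/
structure Tuple.HasDistances (𝔘 : Tuple) {X : Type w} [𝔘.lang.Structure X] (D : Finset 𝔘.S)
    (A : Set X) : Prop where
  nonempty : 𝔘.S.Nonempty → D.Nonempty
  exists_dist : 𝔘.S.Nonempty → ∀ x ∈ A, ∀ y ∈ A, x ≠ y →
    ∃ d ∈ D, ∀ s, 𝔘.relE X s x y ↔ d < s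

lemma Tuple.HasDistances.mono {D : Finset 𝔘.S} {A B : Set X} (h : 𝔘.HasDistances D B)
    (hAB : A ⊆ B) : 𝔘.HasDistances D A :=
  ⟨h.nonempty, fun hS x hx y hy => h.exists_dist hS x (hAB hx) y (hAB hy)⟩

lemma Tuple.IsUStructure.exists_hasDistances (hX : 𝔘.IsUStructure X) {A : Set X}
    (hA : A.Finite) : ∃ D : Finset 𝔘.S, 𝔘.HasDistances D A := by
  classical
  rcases 𝔘.S.eq_empty_or_nonempty with hS | ⟨s₀, hs₀⟩
  · exact ⟨∅, by simp [hS], by simp [hS]⟩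
  have key : ∀ p : X × X, ∃ d : 𝔘.S, p.1 ≠ p.2 → ∀ s, 𝔘.relE X s p.1 p.2 ↔ d < s := by
    intro p
    by_cases hp : p.1 = p.2
    · exact ⟨⟨s₀, hs₀⟩, fun h => (h hp).elim⟩
    · obtain ⟨d, hd⟩ := hX.exists_dist ⟨s₀, hs₀⟩ hp
      exact ⟨d, fun _ => hd⟩
  choose d hd using key
  have hfin := hA.prod hA
  refine ⟨insert ⟨s₀, hs₀⟩ (hfin.toFinset.image d), fun _ => by simp,
    fun _ x hx y hy hxy => ⟨d (x, y), ?_, hd (x, y) hxy⟩⟩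
  exact Finset.mem_insert_of_mem (Finset.mem_image_of_mem _ (by simpa using ⟨hx, hy⟩))

end Distances

/-! ### Building `𝔘`-structures with finitely many distances -/

section Construction

variable {𝔘 : Tuple} {X : Type w}

/-- The structure on `X` with relations `P`, in which the distances belong to `D`, and
distinct points `x, y` are at distance at most `t ∈ D` if and only if `t` is maximal or `R t x y`. -/
@[reducible] def Tuple.mkStructure (D : Finset 𝔘.S) (R : 𝔘.S → X → X → Prop)
    (P : ∀ i : Fin 𝔘.r, (Fin (𝔘.arity i) → X) → Prop) : 𝔘.lang.Structure X where
  funMap := fun {n} F => (inferInstance : IsEmpty (𝔘.lang.Functions n)).elim F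
  RelMap := fun {_} r => match r with
    | Tuple.Rel.E s => fun x => x 0 = x 1 ∨ (∀ t ∈ D, t < s) ∨ ∃ t ∈ D, t < s ∧ R t (x 0) (x 1)
    | Tuple.Rel.P i => fun x => P i x

variable {D : Finset 𝔘.S} {R : 𝔘.S → X → X → Prop}
  {P : ∀ i : Fin 𝔘.r, (Fin (𝔘.arity i) → X) → Prop}

lemma Tuple.relE_mkStructure (s : 𝔘.S) (x y : X) :
    @Tuple.relE 𝔘 X (Tuple.mkStructure D R P) s x y ↔
      x = y ∨ (∀ t ∈ D, t < s) ∨ ∃ t ∈ D, t < s ∧ R t x y :=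
  Iff.rfl

/-- Distinct points have as distance the least `t ∈ D` with `R t x y`, or `max D` if there is none;
the maximum is inserted below so that the minimum is always defined. -/
lemma Tuple.isUStructure_mkStructure (hD : 𝔘.S.Nonempty → D.Nonempty)
    (hR : ∀ t, Equivalence (R t)) (hmono : ∀ t t', t ≤ t' → ∀ x y, R t x y → R t' x y)
    (hsymm : ∀ i, ∀ ϑ ∈ 𝔘.sym i, ∀ x, P i x → P i (x ∘ ϑ))
    (hdist : ∀ i x, P i x → Function.Injective x) :
    @Tuple.IsUStructure 𝔘 X (Tuple.mkStructure D R P) := by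
  let := Tuple.mkStructure D R P
  refine ⟨fun i ϑ hϑ x => ⟨fun h => ?_, hsymm i ϑ hϑ x⟩, hdist,
    fun s => ⟨fun x => Or.inl rfl, fun {x y} h => ?_, fun {x y z} h h' => ?_⟩,
    fun s s' hss' x y h => ?_, fun hS x y hxy => ?_⟩
  · have := hsymm i ϑ⁻¹ (inv_mem hϑ) _ h
    have e : (x ∘ ϑ) ∘ (ϑ⁻¹ : Equiv.Perm _) = x := by
      funext j; simp
    rwa [e] at this
  · rw [Tuple.relE_mkStructure] at h ⊢
    rcases h with h | h | ⟨t, ht, hts, h⟩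
    · exact Or.inl h.symm
    · exact Or.inr (Or.inl h)
    · exact Or.inr (Or.inr ⟨t, ht, hts, (hR t).symm h⟩)
  · rw [Tuple.relE_mkStructure] at h h' ⊢
    rcases h with rfl | h | ⟨t, ht, hts, h⟩
    · exact h'
    · exact Or.inr (Or.inl h)
    rcases h' with rfl | h' | ⟨t', ht', hts', h'⟩
    · exact Or.inr (Or.inr ⟨t, ht, hts, h⟩)
    · exact Or.inr (Or.inl h')
    rcases le_total t t' with hle | hle
    · exact Or.inr (Or.inr ⟨t', ht', hts', (hR t').trans (hmono _ _ hle _ _ h) h'⟩)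
    · exact Or.inr (Or.inr ⟨t, ht, hts, (hR t).trans h (hmono _ _ hle _ _ h')⟩)
  · rw [Tuple.relE_mkStructure] at h ⊢
    rcases h with h | h | ⟨t, ht, hts, h⟩
    · exact Or.inl h
    · exact Or.inr (Or.inl fun t ht => (h t ht).trans hss')
    · exact Or.inr (Or.inr ⟨t, ht, hts.trans hss', h⟩)
  · classical
    set m := D.max' (hD hS) with hm
    have hmD : m ∈ D := D.max'_mem _
    have hne : (insert m (D.filter fun t => R t x y)).Nonempty := ⟨m, by simp⟩
    have hsub : ∀ t ∈ insert m (D.filter fun t => R t x y), t ∈ D := by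
      intro t ht
      rcases Finset.mem_insert.1 ht with rfl | ht
      · exact hmD
      · exact (Finset.mem_filter.1 ht).1
    refine ⟨(insert m (D.filter fun t => R t x y)).min' hne, ?_, ?_⟩
    · change ¬ (x = y ∨ _)
      rintro (h | h | ⟨t, ht, hts, h⟩)
      · exact hxy h
      · exact absurd (h _ (hsub _ (Finset.min'_mem _ _))) (lt_irrefl _)
      · exact absurd hts (not_lt.2 (Finset.min'_le _ _
          (Finset.mem_insert_of_mem (Finset.mem_filter.2 ⟨ht, h⟩))))
    · intro s hs
      have hs : ¬ (x = y ∨ (∀ t ∈ D, t < s) ∨ ∃ t ∈ D, t < s ∧ R t x y) := hs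
      refine Finset.le_min' _ _ _ fun t ht => ?_
      by_contra hts
      rw [not_le] at hts
      rcases Finset.mem_insert.1 ht with rfl | ht
      · exact hs (Or.inr (Or.inl fun t' ht' => (D.le_max' t' ht').trans_lt hts))
      · rw [Finset.mem_filter] at ht
        exact hs (Or.inr (Or.inr ⟨t, ht.1, hts, ht.2⟩))

/-- All distances in `A` lie in `D`, so the relations `E_s` on `A` are determined by the closed
balls with radii in `D`. -/
lemma Tuple.isEmbOn_mkStructure {U : Type w'} [𝔘.lang.Structure U] (hU : 𝔘.IsUStructure U)
    {A : Set U} (hD : 𝔘.HasDistances D A) {j : U → X} (hj : Set.InjOn j A)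
    (hR : ∀ t ∈ D, ∀ a ∈ A, ∀ b ∈ A, R t (j a) (j b) ↔ 𝔘.relLe U t a b)
    (hP : ∀ i x, (∀ k, x k ∈ A) → (P i (j ∘ x) ↔ 𝔘.relP U i x)) :
    @Tuple.IsEmbOn 𝔘 U X _ (Tuple.mkStructure D R P) A j := by
  let := Tuple.mkStructure D R P
  refine ⟨hj, fun s a ha b hb => ?_, hP⟩
  rw [Tuple.relE_mkStructure]
  have hS : 𝔘.S.Nonempty := ⟨s, s.2⟩
  by_cases hab : a = b
  · subst hab
    simp [(hU.equivalence_E s).refl a]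
  obtain ⟨d, hdD, hd⟩ := hD.exists_dist hS a ha b hb hab
  constructor
  · rintro (h | h | ⟨t, ht, hts, h⟩)
    · exact (hab (hj ha hb h)).elim
    · exact (hd s).2 (h d hdD)
    · exact (hR t ht a ha b hb).1 h s hts
  · intro h
    exact Or.inr (Or.inr ⟨d, hdD, (hd s).1 h, (hR d hdD a ha b hb).2 fun s' => (hd s').2⟩)

lemma Tuple.isEmbOn_mkStructure_self {Z : Set X} {f : X → X} (hf : Set.InjOn f Z)
    (hR : ∀ t, ∀ x ∈ Z, ∀ y ∈ Z, R t (f x) (f y) ↔ R t x y)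
    (hP : ∀ i x, (∀ k, x k ∈ Z) → (P i (f ∘ x) ↔ P i x)) :
    @Tuple.IsEmbOn 𝔘 X X (Tuple.mkStructure D R P) (Tuple.mkStructure D R P) Z f := by
  let := Tuple.mkStructure D R P
  refine ⟨hf, fun s x hx y hy => ?_, hP⟩
  rw [Tuple.relE_mkStructure, Tuple.relE_mkStructure, hf.eq_iff hx hy]
  simp only [hR _ x hx y hy]

end Construction

/-! ### Actions on finite substructures -/

section PartialRepresentations

variable {𝔘 : Tuple} {U : Type w} [𝔘.lang.Structure U] {Γ : Type*} [Group Γ]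

/-- An action of `Γ` by automorphisms on the finite substructure `B` of a homogeneous structure,
extended to all of `U` by the identity. -/
structure IsPartialRep (𝔘 : Tuple) {U : Type w} [𝔘.lang.Structure U] {Γ : Type*} [Group Γ]
    (B : Set U) (β : Γ →* Equiv.Perm U) : Prop where
  finite : B.Finite
  mapsTo : ∀ γ, Set.MapsTo (β γ) B B
  eq_self : ∀ γ, ∀ u ∉ B, β γ u = u
  exists_aut : ∀ γ, ∃ h : Aut 𝔘.lang U, ∀ b ∈ B, h b = β γ b

/-- Being trivial off `B`, each permutation is determined by its restriction to the finite set `B`.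
The resulting finite group will index new orbits. -/
lemma IsPartialRep.finite_range {B : Set U} {β : Γ →* Equiv.Perm U} (h : IsPartialRep 𝔘 B β) :
    (Set.range β).Finite := by
  have := h.finite.to_subtype
  refine Set.Finite.of_finite_image (f := fun (q : Equiv.Perm U) (b : B) => q b)
    ((Set.finite_range fun (f : B → B) (b : B) => (f b : U)).subset ?_) ?_
  · rintro _ ⟨_, ⟨γ, rfl⟩, rfl⟩
    exact ⟨fun b => ⟨β γ b, h.mapsTo γ b.2⟩, rfl⟩
  · rintro _ ⟨γ, rfl⟩ _ ⟨δ, rfl⟩ hγδ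
    ext u
    by_cases hu : u ∈ B
    · exact congrFun hγδ ⟨u, hu⟩
    · rw [h.eq_self γ u hu, h.eq_self δ u hu]

/-- An action on a finite part `Z` of a `𝔘`-structure `X` is realised by a partial representation,
with a prescribed position of the finite set `A`. -/
lemma Tuple.IsRandomisedUltrametricSpace.exists_isPartialRep [Countable U]
    (hU : 𝔘.IsRandomisedUltrametricSpace U) {X : Type w} [𝔘.lang.Structure X]
    (hX : 𝔘.IsUStructure X) {Z : Set X} (hZ : Z.Finite) (α : Γ →* Equiv.Perm X)
    (hαZ : ∀ γ, Set.MapsTo (α γ) Z Z) (hα : ∀ γ, 𝔘.IsEmbOn Z (α γ))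
    {A : Set U} (hA : A.Finite) {j : U → X} (hj : 𝔘.IsEmbOn A j) (hjZ : Set.MapsTo j A Z) :
    ∃ (B : Set U) (β : Γ →* Equiv.Perm U) (e : X → U), IsPartialRep 𝔘 B β ∧ 𝔘.IsEmbOn Z e ∧
      Set.MapsTo e Z B ∧ (∀ a ∈ A, e (j a) = a) ∧ ∀ γ, ∀ z ∈ Z, e (α γ z) = β γ (e z) := by
  classical
  obtain ⟨e, he, hej⟩ := hU.exists_isEmbOn hX hZ hA hj hjZ
  let sm : Γ → U → U := fun γ u => if h : ∃ z ∈ Z, e z = u then e (α γ h.choose) else u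
  have key : ∀ γ, ∀ z ∈ Z, sm γ (e z) = e (α γ z) := by
    intro γ z hz
    have h : ∃ z' ∈ Z, e z' = e z := ⟨z, hz, rfl⟩
    have : h.choose = z := he.injOn h.choose_spec.1 hz h.choose_spec.2
    simp only [sm, dif_pos h, this]
  have key' : ∀ γ, ∀ u ∉ e '' Z, sm γ u = u := fun γ u hu => dif_neg hu
  let act : MulAction Γ U :=
    { smul := sm
      one_smul := by
        intro u
        change sm 1 u = u
        by_cases hu : u ∈ e '' Z
        · obtain ⟨z, hz, rfl⟩ := hu
          simp [key _ z hz]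
        · exact key' _ u hu
      mul_smul := by
        intro γ δ u
        change sm (γ * δ) u = sm γ (sm δ u)
        by_cases hu : u ∈ e '' Z
        · obtain ⟨z, hz, rfl⟩ := hu
          rw [key _ z hz, key _ z hz, key _ _ (hαZ δ hz)]
          simp
        · rw [key' _ u hu, key' _ u hu, key' _ u hu] }
  let β := @MulAction.toPermHom Γ U _ act
  have hβ : ∀ γ u, β γ u = sm γ u := fun _ _ => rfl
  refine ⟨e '' Z, β, e, ⟨hZ.image e, ?_, ?_, ?_⟩, he, Set.mapsTo_image e Z, hej, ?_⟩
  · rintro γ _ ⟨z, hz, rfl⟩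
    rw [hβ, key γ z hz]
    exact ⟨_, hαZ γ hz, rfl⟩
  · exact fun γ u hu => key' γ u hu
  · intro γ
    -- An inverse of `e` on `e '' Z`, with a filler value elsewhere; the transported permutation is
    -- `e ∘ α γ ∘ r`, a finite partial isomorphism to which homogeneity applies.
    let r : U → X := fun u => if h : ∃ z ∈ Z, e z = u then h.choose else j u
    have hr : ∀ z ∈ Z, r (e z) = z := by
      intro z hz
      have h : ∃ z' ∈ Z, e z' = e z := ⟨z, hz, rfl⟩
      simp only [r, dif_pos h]
      exact he.injOn h.choose_spec.1 hz h.choose_spec.2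
    have hrm : Set.MapsTo r (e '' Z) Z := by
      rintro _ ⟨z, hz, rfl⟩
      rwa [hr z hz]
    have hre : 𝔘.IsEmbOn (e '' Z) r := by
      refine he.of_leftInvOn hrm ?_
      rintro _ ⟨z, hz, rfl⟩
      rw [hr z hz]
    obtain ⟨g, hg⟩ := hU.exists_aut (hZ.image e)
      ((he.comp (hα γ) (hαZ γ)).comp hre hrm)
    refine ⟨g, ?_⟩
    rintro _ ⟨z, hz, rfl⟩
    rw [hg _ ⟨z, hz, rfl⟩, hβ, key γ z hz]
    simp [hr z hz]
  · intro γ z hz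
    rw [hβ, key γ z hz]

end PartialRepresentations

/-! ### Free amalgamation -/

section Amalgamation

variable {𝔘 : Tuple} {U : Type w} [𝔘.lang.Structure U] {X I : Type*}

/-- The relation of being at distance at most `t` in the free amalgam over `A` of the sets
`A ∪ side ⁻¹' {c}`, each of which is given the structure induced by `π : X → U`. -/
def Tuple.amalgamLe (𝔘 : Tuple) {U : Type w} [𝔘.lang.Structure U] {X I : Type*} (π : X → U)
    (side : X → I) (A : Set X) (t : 𝔘.S) (x y : X) : Prop :=
  -- Across sides, the distance is measured through a point `a` of `A`; by the first conjunct, the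
  -- bound on `x` and `a` also bounds the distance from `a` to `y`.
  𝔘.relLe U t (π x) (π y) ∧ (side x = side y ∨ ∃ a ∈ A, 𝔘.relLe U t (π x) (π a))

/-- The relations `P i` in the free amalgam. -/
def Tuple.amalgamP (𝔘 : Tuple) {U : Type w} [𝔘.lang.Structure U] {X I : Type*} (π : X → U)
    (side : X → I) (A : Set X) (i : Fin 𝔘.r) (x : Fin (𝔘.arity i) → X) : Prop :=
  𝔘.relP U i (π ∘ x) ∧ ∃ k₀, ∀ k, x k ∈ A ∨ side (x k) = side (x k₀)

/-- The free amalgam over `A` of the sets `A ∪ side ⁻¹' {c}`. -/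
@[reducible] def Tuple.amalgam (D : Finset 𝔘.S) (π : X → U) (side : X → I) (A : Set X) :
    𝔘.lang.Structure X :=
  Tuple.mkStructure D (𝔘.amalgamLe π side A) (𝔘.amalgamP π side A)

variable {D : Finset 𝔘.S} {π : X → U} {side : X → I} {A : Set X}

lemma Tuple.IsUStructure.amalgam (hU : 𝔘.IsUStructure U) (hD : 𝔘.S.Nonempty → D.Nonempty) :
    @Tuple.IsUStructure 𝔘 X (Tuple.amalgam D π side A) := by
  have hR := hU.equivalence_relLe
  refine Tuple.isUStructure_mkStructure hD (fun t => ⟨fun x => ?_, ?_, ?_⟩) ?_ ?_ ?_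
  · exact ⟨(hR t).refl _, Or.inl rfl⟩
  · rintro x y ⟨h, h' | ⟨a, ha, h'⟩⟩
    · exact ⟨(hR t).symm h, Or.inl h'.symm⟩
    · exact ⟨(hR t).symm h, Or.inr ⟨a, ha, (hR t).trans ((hR t).symm h) h'⟩⟩
  · rintro x y z ⟨h, h'⟩ ⟨k, k'⟩
    refine ⟨(hR t).trans h k, ?_⟩
    rcases h' with h' | h'
    · rcases k' with k' | ⟨a, ha, k'⟩
      · exact Or.inl (h'.trans k')
      · exact Or.inr ⟨a, ha, (hR t).trans h k'⟩
    · exact Or.inr h'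
  · rintro t t' htt' x y ⟨h, h' | ⟨a, ha, h'⟩⟩
    · exact ⟨Tuple.relLe_mono htt' h, Or.inl h'⟩
    · exact ⟨Tuple.relLe_mono htt' h, Or.inr ⟨a, ha, Tuple.relLe_mono htt' h'⟩⟩
  · rintro i ϑ hϑ x ⟨h, k₀, hk⟩
    refine ⟨(hU.symm_P i ϑ hϑ (π ∘ x)).2 h, ϑ⁻¹ k₀, fun k => ?_⟩
    simpa using hk (ϑ k)
  · rintro i x ⟨h, -⟩
    exact (hU.distinct_P i _ h).of_comp

/-- The image of `B` lies in the single piece of side `c` together with `A`, where the amalgam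
carries the structure induced by `π`. -/
lemma Tuple.isEmbOn_amalgam (hU : 𝔘.IsUStructure U) {B : Set U} (hD : 𝔘.HasDistances D B)
    {j : U → X} (h : Aut 𝔘.lang U) (hj : ∀ b ∈ B, π (j b) = h b) (c : I)
    (hc : ∀ b ∈ B, j b ∈ A ∨ side (j b) = c) :
    @Tuple.IsEmbOn 𝔘 U X _ (Tuple.amalgam D π side A) B j := by
  have hR := hU.equivalence_relLe
  refine Tuple.isEmbOn_mkStructure hU hD (fun a ha b hb hab => ?_) (fun t _ a ha b hb => ?_)
    fun i x hx => ?_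
  · have := congrArg π hab
    rw [hj a ha, hj b hb] at this
    exact h.injective this
  · have e : 𝔘.relLe U t (π (j a)) (π (j b)) ↔ 𝔘.relLe U t a b := by
      rw [hj a ha, hj b hb, h.relLe_iff]
    refine ⟨fun k => e.1 k.1, fun k => ⟨e.2 k, ?_⟩⟩
    rcases hc a ha with h₁ | h₁
    · exact Or.inr ⟨j a, h₁, (hR t).refl _⟩
    rcases hc b hb with h₂ | h₂
    · exact Or.inr ⟨j b, h₂, e.2 k⟩
    · exact Or.inl (h₁.trans h₂.symm)
  · have e : 𝔘.relP U i (π ∘ (j ∘ x)) ↔ 𝔘.relP U i x := by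
      have : π ∘ (j ∘ x) = h ∘ x := funext fun k => hj _ (hx k)
      rw [this, h.relP_iff]
    refine ⟨fun k => e.1 k.1, fun k => ⟨e.2 k, ?_⟩⟩
    by_cases hk : ∃ k₀, side (j (x k₀)) = c
    · obtain ⟨k₀, hk₀⟩ := hk
      exact ⟨k₀, fun k => (hc _ (hx k)).imp_right fun h => h.trans hk₀.symm⟩
    · exact ⟨⟨0, 𝔘.arity_pos i⟩, fun k =>
        Or.inl ((hc _ (hx k)).resolve_right fun h => hk ⟨k, h⟩)⟩

/-- Different pieces may be moved by unrelated automorphisms of `U`, since they interact only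
through `A`. Preservation of the relations suffices: reflection follows by applying it to `γ⁻¹`. -/
lemma Tuple.isEmbOn_amalgam_self (hU : 𝔘.IsUStructure U) {Γ : Type*} [Group Γ]
    (α : Γ →* Equiv.Perm X) {Z : Set X} (hαZ : ∀ γ, Set.MapsTo (α γ) Z Z) (hAZ : A ⊆ Z)
    (hαA : ∀ γ, Set.MapsTo (α γ) A A)
    (hside : ∀ γ, ∀ x ∈ Z, ∀ y ∈ Z, side x = side y → side (α γ x) = side (α γ y))
    (hα : ∀ γ, ∀ x ∈ Z, ∃ h : Aut 𝔘.lang U, ∀ y ∈ Z, (y ∈ A ∨ side y = side x) →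
      π (α γ y) = h (π y)) (γ : Γ) :
    @Tuple.IsEmbOn 𝔘 X X (Tuple.amalgam D π side A) (Tuple.amalgam D π side A) Z (α γ) := by
  have hR := hU.equivalence_relLe
  have toA : ∀ γ t, ∀ x ∈ Z, ∀ a ∈ A, 𝔘.relLe U t (π x) (π a) →
      𝔘.relLe U t (π (α γ x)) (π (α γ a)) := by
    intro γ t x hx a ha h
    obtain ⟨g, hg⟩ := hα γ x hx
    rwa [hg x hx (Or.inr rfl), hg a (hAZ ha) (Or.inl ha), g.relLe_iff]
  have R1 : ∀ γ t, ∀ x ∈ Z, ∀ y ∈ Z, 𝔘.amalgamLe π side A t x y →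
      𝔘.amalgamLe π side A t (α γ x) (α γ y) := by
    rintro γ t x hx y hy ⟨h, h' | ⟨a, ha, h'⟩⟩
    · obtain ⟨g, hg⟩ := hα γ x hx
      refine ⟨?_, Or.inl (hside γ x hx y hy h')⟩
      rwa [hg x hx (Or.inr rfl), hg y hy (Or.inr h'.symm), g.relLe_iff]
    · have h₁ := toA γ t x hx a ha h'
      have h₂ := toA γ t y hy a ha ((hR t).trans ((hR t).symm h) h')
      exact ⟨(hR t).trans h₁ ((hR t).symm h₂), Or.inr ⟨_, hαA γ ha, h₁⟩⟩
  have P1 : ∀ γ i (x : Fin (𝔘.arity i) → X), (∀ k, x k ∈ Z) → 𝔘.amalgamP π side A i x →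
      𝔘.amalgamP π side A i (α γ ∘ x) := by
    rintro γ i x hx ⟨h, k₀, hk⟩
    obtain ⟨g, hg⟩ := hα γ (x k₀) (hx k₀)
    refine ⟨?_, k₀, fun k => (hk k).imp (fun h => hαA γ h) (hside γ _ (hx k) _ (hx k₀))⟩
    have : π ∘ (α γ ∘ x) = g ∘ (π ∘ x) := funext fun k => hg _ (hx k) (hk k)
    rwa [this, g.relP_iff]
  have hinv : ∀ x, α γ⁻¹ (α γ x) = x := fun x => by simp
  refine Tuple.isEmbOn_mkStructure_self (α γ).injective.injOn (fun t x hx y hy => ⟨fun h => ?_,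
    R1 γ t x hx y hy⟩) fun i x hx => ⟨fun h => ?_, P1 γ i x hx⟩
  · simpa [hinv] using R1 γ⁻¹ t _ (hαZ γ hx) _ (hαZ γ hy) h
  · have := P1 γ⁻¹ i (α γ ∘ x) (fun k => hαZ γ (hx k)) h
    have e : α γ⁻¹ ∘ (α γ ∘ x) = x := funext fun k => hinv _
    rwa [e] at this

end Amalgamation

/-! ### Extension and amalgamation of finite partial representations -/

section AmalgamationOfActions

variable {𝔘 : Tuple} {U : Type w} [𝔘.lang.Structure U] [Countable U] {Γ : Type*} [Group Γ]

/-- A partial representation extends to any further point. -/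
lemma IsPartialRep.exists_extension (hU : 𝔘.IsRandomisedUltrametricSpace U) {B : Set U}
    {β : Γ →* Equiv.Perm U} (hβ : IsPartialRep 𝔘 B β) (u : U) :
    ∃ (B' : Set U) (β' : Γ →* Equiv.Perm U), IsPartialRep 𝔘 B' β' ∧ B ⊆ B' ∧ u ∈ B' ∧
      ∀ γ, ∀ b ∈ B, β' γ b = β γ b := by
  classical
  have hUs := hU.isUStructure
  by_cases hu : u ∈ B
  · exact ⟨B, β, hβ, subset_rfl, hu, fun _ _ _ => rfl⟩
  have key : ∀ q : Equiv.Perm U, ∃ h : Aut 𝔘.lang U, q ∈ Set.range β → ∀ b ∈ B, h b = q b := by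
    intro q
    by_cases hq : q ∈ Set.range β
    · obtain ⟨γ, rfl⟩ := hq
      obtain ⟨h, hh⟩ := hβ.exists_aut γ
      exact ⟨h, fun _ => hh⟩
    · exact ⟨1, fun h => (hq h).elim⟩
  choose h hh using key
  have hh : ∀ γ, ∀ b ∈ B, h (β γ) b = β γ b := fun γ => hh _ ⟨γ, rfl⟩
  -- The new orbit has one point for each `q` in the finite group `Set.range β`, lying over `B` as
  -- `h q u` does. `Γ` permutes these points by left multiplication. As they are amalgamated freely
  -- over `B`, the choice of `h` need not be multiplicative.
  let π : U ⊕ Equiv.Perm U → U := Sum.elim id fun q => h q u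
  let side : U ⊕ Equiv.Perm U → Option (Equiv.Perm U) := Sum.elim (fun _ => none) some
  let α : Γ →* Equiv.Perm (U ⊕ Equiv.Perm U) := (Equiv.Perm.sumCongrHom _ _).comp
    (β.prod ((MulAction.toPermHom (Equiv.Perm U) (Equiv.Perm U)).comp β))
  have α_inl : ∀ γ b, α γ (Sum.inl b) = Sum.inl (β γ b) := fun _ _ => rfl
  have α_inr : ∀ γ q, α γ (Sum.inr q) = Sum.inr (β γ * q) := fun _ _ => rfl
  let Z : Set (U ⊕ Equiv.Perm U) := Sum.inl '' B ∪ Sum.inr '' Set.range β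
  have hZ : Z.Finite := (hβ.finite.image _).union (hβ.finite_range.image _)
  have hαZ : ∀ γ, Set.MapsTo (α γ) Z Z := by
    rintro γ _ (⟨b, hb, rfl⟩ | ⟨_, ⟨δ, rfl⟩, rfl⟩)
    · exact Or.inl ⟨_, hβ.mapsTo γ hb, rfl⟩
    · exact Or.inr ⟨_, ⟨γ * δ, map_mul β γ δ⟩, rfl⟩
  have hαA : ∀ γ, Set.MapsTo (α γ) (Sum.inl '' B) (Sum.inl '' B) := by
    rintro γ _ ⟨b, hb, rfl⟩
    exact ⟨_, hβ.mapsTo γ hb, rfl⟩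
  have hside : ∀ γ, ∀ x ∈ Z, ∀ y ∈ Z, side x = side y → side (α γ x) = side (α γ y) := by
    rintro γ (x | x) - (y | y) - hxy
    · rfl
    · simp [side] at hxy
    · simp [side] at hxy
    · have : x = y := by simpa [side] using hxy
      rw [this]
  have hα : ∀ γ, ∀ x ∈ Z, ∃ g : Aut 𝔘.lang U, ∀ y ∈ Z, (y ∈ Sum.inl '' B ∨ side y = side x) →
      π (α γ y) = g (π y) := by
    rintro γ _ (⟨b, hb, rfl⟩ | ⟨_, ⟨δ, rfl⟩, rfl⟩)
    · refine ⟨h (β γ), ?_⟩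
      rintro _ (⟨b', hb', rfl⟩ | ⟨q, -, rfl⟩) hy
      · exact (hh γ b' hb').symm
      · simp [side] at hy
    -- This automorphism takes the position of the copy `β δ` to that of `β (γ * δ)` and acts on `B`
    -- as `β γ`.
    · refine ⟨h (β (γ * δ)) * (h (β δ))⁻¹, ?_⟩
      rintro _ (⟨b', hb', rfl⟩ | ⟨q, -, rfl⟩) hy
      · have e : (h (β δ))⁻¹ b' = β δ⁻¹ b' := by
          have := hh δ _ (hβ.mapsTo δ⁻¹ hb')
          have e' : β δ (β δ⁻¹ b') = b' := by simp
          rw [e'] at this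
          conv_lhs => rw [← this]
          exact (h (β δ)).toEquiv.symm_apply_apply _
        change β γ b' = h (β (γ * δ)) ((h (β δ))⁻¹ b')
        rw [e, hh _ _ (hβ.mapsTo δ⁻¹ hb'), ← Equiv.Perm.mul_apply, ← map_mul, mul_inv_cancel_right]
      · have : q = β δ := by simpa [side] using hy
        subst this
        change h (β γ * β δ) u = h (β (γ * δ)) ((h (β δ))⁻¹ (h (β δ) u))
        rw [map_mul]
        exact congrArg _ ((h (β δ)).toEquiv.symm_apply_apply _).symm
  have hA : (insert u B).Finite := hβ.finite.insert u
  obtain ⟨D, hD⟩ := hUs.exists_hasDistances hA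
  let := Tuple.amalgam D π side (Sum.inl '' B)
  let j : U → U ⊕ Equiv.Perm U := fun b => if b ∈ B then Sum.inl b else Sum.inr 1
  have hjB : ∀ b ∈ B, j b = Sum.inl b := fun b hb => if_pos hb
  have hju : j u = Sum.inr 1 := if_neg hu
  have hj : 𝔘.IsEmbOn (insert u B) j := by
    -- The original `u` is identified with the copy indexed by `1`; this is legitimate because `h 1`
    -- fixes `B` pointwise.
    refine Tuple.isEmbOn_amalgam hUs hD (h 1) ?_ (some 1) ?_
    · rintro b (rfl | hb)
      · rw [hju]; rfl
      · rw [hjB b hb]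
        have := hh 1 b hb
        rw [map_one] at this
        exact this.symm
    · rintro b (rfl | hb)
      · rw [hju]; exact Or.inr rfl
      · rw [hjB b hb]; exact Or.inl ⟨b, hb, rfl⟩
  have hjZ : Set.MapsTo j (insert u B) Z := by
    rintro b (rfl | hb)
    · rw [hju]; exact Or.inr ⟨1, ⟨1, map_one β⟩, rfl⟩
    · rw [hjB b hb]; exact Or.inl ⟨b, hb, rfl⟩
  obtain ⟨B', β', e, hβ', -, heZ, hej, heα⟩ := hU.exists_isPartialRep
    (hUs.amalgam hD.nonempty) hZ α hαZ
    (Tuple.isEmbOn_amalgam_self hUs α hαZ Set.subset_union_left hαA hside hα) hA hj hjZ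
  have hsub : insert u B ⊆ B' := fun b hb => by
    rw [← hej b hb]
    exact heZ (hjZ hb)
  refine ⟨B', β', hβ', fun b hb => hsub (Or.inr hb), hsub (Or.inl rfl), fun γ b hb => ?_⟩
  have := heα γ (j b) (hjZ (Or.inr hb))
  rw [hej b (Or.inr hb), hjB b hb, α_inl, ← hjB _ (hβ.mapsTo γ hb),
    hej _ (Or.inr (hβ.mapsTo γ hb))] at this
  exact this.symm

/-- Amalgamation of partial representations over a common part. -/
lemma IsPartialRep.exists_amalgam (hU : 𝔘.IsRandomisedUltrametricSpace U) {A B C : Set U}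
    {β θ : Γ →* Equiv.Perm U} (hβ : IsPartialRep 𝔘 B β) (hθ : IsPartialRep 𝔘 C θ)
    (hAB : A ⊆ B) (hAC : A ⊆ C) (hA : ∀ γ, Set.MapsTo (β γ) A A)
    (hβθ : ∀ γ, ∀ a ∈ A, θ γ a = β γ a) :
    ∃ (C' : Set U) (θ' : Γ →* Equiv.Perm U) (g : U → U), IsPartialRep 𝔘 C' θ' ∧ C ⊆ C' ∧
      (∀ γ, ∀ c ∈ C, θ' γ c = θ γ c) ∧ 𝔘.IsEmbOn B g ∧ Set.MapsTo g B C' ∧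
      (∀ a ∈ A, g a = a) ∧ ∀ γ, ∀ b ∈ B, θ' γ (g b) = g (β γ b) := by
  classical
  have hUs := hU.isUStructure
  have hA' : ∀ γ, ∀ b ∈ B, b ∉ A → β γ b ∉ A := by
    intro γ b _ hbA h
    have := hA γ⁻¹ h
    have e : β γ⁻¹ (β γ b) = b := by simp
    exact hbA (e ▸ this)
  let π : U ⊕ U → U := Sum.elim id id
  let side : U ⊕ U → Bool := Sum.isLeft
  let α : Γ →* Equiv.Perm (U ⊕ U) := (Equiv.Perm.sumCongrHom _ _).comp (θ.prod β)
  have α_inl : ∀ γ c, α γ (Sum.inl c) = Sum.inl (θ γ c) := fun _ _ => rfl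
  have α_inr : ∀ γ b, α γ (Sum.inr b) = Sum.inr (β γ b) := fun _ _ => rfl
  -- The common part `A` is kept only in the left summand; `B \ A` is invariant because `A` is.
  let Z : Set (U ⊕ U) := Sum.inl '' C ∪ Sum.inr '' (B \ A)
  have hZ : Z.Finite := (hθ.finite.image _).union (hβ.finite.sdiff.image _)
  have hαZ : ∀ γ, Set.MapsTo (α γ) Z Z := by
    rintro γ _ (⟨c, hc, rfl⟩ | ⟨b, hb, rfl⟩)
    · exact Or.inl ⟨_, hθ.mapsTo γ hc, rfl⟩
    · exact Or.inr ⟨_, ⟨hβ.mapsTo γ hb.1, hA' γ b hb.1 hb.2⟩, rfl⟩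
  have hAZ : Sum.inl '' A ⊆ Z := (Set.image_mono hAC).trans Set.subset_union_left
  have hαA : ∀ γ, Set.MapsTo (α γ) (Sum.inl '' A) (Sum.inl '' A) := by
    rintro γ _ ⟨a, ha, rfl⟩
    refine ⟨_, hA γ ha, ?_⟩
    rw [α_inl, hβθ γ a ha]
  have hside : ∀ γ, ∀ x ∈ Z, ∀ y ∈ Z, side x = side y → side (α γ x) = side (α γ y) := by
    rintro γ (x | x) - (y | y) - hxy <;> exact hxy
  have hα : ∀ γ, ∀ x ∈ Z, ∃ g : Aut 𝔘.lang U, ∀ y ∈ Z, (y ∈ Sum.inl '' A ∨ side y = side x) →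
      π (α γ y) = g (π y) := by
    rintro γ _ (⟨c, hc, rfl⟩ | ⟨b, hb, rfl⟩)
    · obtain ⟨g, hg⟩ := hθ.exists_aut γ
      refine ⟨g, ?_⟩
      rintro _ (⟨c', hc', rfl⟩ | ⟨b, hb, rfl⟩) hy
      · exact (hg c' hc').symm
      · simp [side] at hy
    · obtain ⟨g, hg⟩ := hβ.exists_aut γ
      refine ⟨g, ?_⟩
      rintro _ (⟨c', hc', rfl⟩ | ⟨b', hb', rfl⟩) hy
      · have hc'A : c' ∈ A := by simpa [side] using hy
        exact (hβθ γ c' hc'A).trans (hg c' (hAB hc'A)).symm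
      · exact (hg b' hb'.1).symm
  have hfin : (C ∪ B).Finite := hθ.finite.union hβ.finite
  obtain ⟨D, hD⟩ := hUs.exists_hasDistances hfin
  let := Tuple.amalgam D π side (Sum.inl '' A)
  have hj : 𝔘.IsEmbOn C (Sum.inl : U → U ⊕ U) :=
    Tuple.isEmbOn_amalgam hUs (hD.mono Set.subset_union_left) 1 (fun _ _ => rfl) true
      fun _ _ => Or.inr rfl
  have hjZ : Set.MapsTo Sum.inl C Z := fun c hc => Or.inl ⟨c, hc, rfl⟩
  let k : U → U ⊕ U := fun b => if b ∈ A then Sum.inl b else Sum.inr b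
  have kA : ∀ b ∈ A, k b = Sum.inl b := fun b hb => if_pos hb
  have kA' : ∀ b ∉ A, k b = Sum.inr b := fun b hb => if_neg hb
  have hk : 𝔘.IsEmbOn B k := by
    refine Tuple.isEmbOn_amalgam hUs (hD.mono Set.subset_union_right) 1 (fun b hb => ?_) false
      fun b hb => ?_
    · by_cases hbA : b ∈ A
      · rw [kA b hbA]; rfl
      · rw [kA' b hbA]; rfl
    · by_cases hbA : b ∈ A
      · rw [kA b hbA]; exact Or.inl ⟨b, hbA, rfl⟩
      · rw [kA' b hbA]; exact Or.inr rfl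
  have hkZ : Set.MapsTo k B Z := by
    intro b hb
    by_cases hbA : b ∈ A
    · rw [kA b hbA]; exact Or.inl ⟨b, hAC hbA, rfl⟩
    · rw [kA' b hbA]; exact Or.inr ⟨b, ⟨hb, hbA⟩, rfl⟩
  have hkα : ∀ γ, ∀ b ∈ B, α γ (k b) = k (β γ b) := by
    intro γ b hb
    by_cases hbA : b ∈ A
    · rw [kA b hbA, kA _ (hA γ hbA), α_inl, hβθ γ b hbA]
    · rw [kA' b hbA, kA' _ (hA' γ b hb hbA), α_inr]
  obtain ⟨C', θ', e, hθ', he, heZ, hej, heα⟩ := hU.exists_isPartialRep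
    (hUs.amalgam hD.nonempty) hZ α hαZ
    (Tuple.isEmbOn_amalgam_self hUs α hαZ hAZ hαA hside hα) hθ.finite hj hjZ
  refine ⟨C', θ', e ∘ k, hθ', fun c hc => ?_, fun γ c hc => ?_, he.comp hk hkZ,
    fun b hb => heZ (hkZ hb), fun a ha => ?_, fun γ b hb => ?_⟩
  · rw [← hej c hc]
    exact heZ (hjZ hc)
  · have := heα γ (Sum.inl c) (hjZ hc)
    rw [hej c hc, α_inl, hej _ (hθ.mapsTo γ hc)] at this
    exact this.symm
  · change e (k a) = a
    rw [kA a ha, hej a (hAC ha)]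
  · change θ' γ (e (k b)) = e (k (β γ b))
    rw [← heα γ _ (hkZ hb), hkα γ b hb]

end AmalgamationOfActions

/-! ### Separating points by powers in finitely generated abelian groups -/

section Separation

variable {G : Type*} [CommGroup G] [Group.FG G]

/-- Some coordinate of `g` in a decomposition into cyclic groups is non-trivial. If it is an integer
`v ≠ 0`, then `|v| + 1` does not divide it; if it lies in `ℤ/p^e`, then `p^e`-th powers vanish
there. -/
lemma exists_forall_pow_ne {g : G} (hg : g ≠ 1) : ∃ m : ℕ, 0 < m ∧ ∀ x : G, x ^ m ≠ g := by
  obtain ⟨ι, j, _, _, p, hp, e, ⟨f⟩⟩ := CommGroup.equiv_free_prod_prod_multiplicative_zmod G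
  have hfg : f g ≠ 1 := by simpa using hg
  by_cases h₁ : ∃ k, (f g).1 k ≠ 1
  · obtain ⟨k, hk⟩ := h₁
    set v : ℤ := Multiplicative.toAdd ((f g).1 k) with hv
    have hv0 : v ≠ 0 := fun h => hk (Multiplicative.toAdd.injective h)
    refine ⟨v.natAbs + 1, Nat.succ_pos _, fun x hx => ?_⟩
    have key : ∀ n : ℕ, x ^ n = g → v = n * Multiplicative.toAdd ((f x).1 k) := by
      rintro n rfl
      simp only [hv, map_pow, Prod.pow_fst, Pi.pow_apply, toAdd_pow, nsmul_eq_mul]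
    have hdvd : ((v.natAbs + 1 : ℕ) : ℤ) ∣ v := ⟨_, key _ hx⟩
    have := Int.natAbs_dvd_natAbs.2 hdvd
    have := Nat.le_of_dvd (Int.natAbs_pos.2 hv0) this
    simp only [Int.natAbs_natCast] at this
    omega
  · by_cases h₂ : ∃ i, (f g).2 i ≠ 1
    · obtain ⟨i, hi⟩ := h₂
      refine ⟨p i ^ e i, pow_pos (hp i).pos _, ?_⟩
      rintro x rfl
      apply hi
      apply Multiplicative.toAdd.injective
      simp only [map_pow, Prod.pow_snd, Pi.pow_apply, toAdd_pow, nsmul_eq_mul, toAdd_one]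
      rw [ZMod.natCast_self, zero_mul]
    · push Not at h₁ h₂
      exact (hfg (Prod.ext (funext h₁) (funext h₂))).elim

/-- The previous lemma is applied to the class of `g` in `G ⧸ H`. -/
lemma Subgroup.exists_forall_mul_pow_notMem (H : Subgroup G) {g : G} (hg : g ∉ H) :
    ∃ m : ℕ, 0 < m ∧ ∀ x : G, g * x ^ m ∉ H := by
  have hg' : (g : G ⧸ H) ≠ 1 := fun h => hg ((QuotientGroup.eq_one_iff g).1 h)
  obtain ⟨m, hm, h⟩ := exists_forall_pow_ne hg'
  refine ⟨m, hm, fun x hx => h ((x⁻¹ : G) : G ⧸ H) ?_⟩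
  have := (QuotientGroup.eq_one_iff (N := H) _).2 hx
  rw [QuotientGroup.mk_mul, QuotientGroup.mk_pow] at this
  rw [QuotientGroup.mk_inv, inv_pow]
  exact (eq_inv_of_mul_eq_one_left this).symm

lemma finite_quotient_range_pow {m : ℕ} (hm : 0 < m) :
    Finite (G ⧸ (powMonoidHom m : G →* G).range) := by
  refine CommGroup.finite_of_fg_isMulTorsion _ fun q => ?_
  induction q using QuotientGroup.induction_on with
  | H x =>
    refine isOfFinOrder_iff_pow_eq_one.2 ⟨m, hm, ?_⟩
    rw [← QuotientGroup.mk_pow, QuotientGroup.eq_one_iff]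
    exact ⟨x, rfl⟩

variable {Y : Type*} [MulAction G Y]

/-- Inequivalent points remain inequivalent after translating one by a suitable power. -/
lemma exists_forall_not_rel_pow_smul {R : Y → Y → Prop} (hR : Equivalence R)
    (hinv : ∀ (γ : G) x y, R x y → R (γ • x) (γ • y)) {a b : Y} (hab : ¬ R a b) :
    ∃ m : ℕ, 0 < m ∧ ∀ x : G, ¬ R a (x ^ m • b) := by
  by_cases hc : ∃ c : G, R a (c • b)
  · obtain ⟨c, hc⟩ := hc
    -- The stabiliser of the `R`-class of `b`. A relation between `a` and `x ^ m • b` would put `c⁻¹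
    -- * x ^ m` into it.
    let H : Subgroup G :=
      { carrier := {γ | R b (γ • b)}
        one_mem' := by simpa using hR.refl b
        mul_mem' := by
          intro γ δ hγ hδ
          have := hinv γ _ _ hδ
          rw [← mul_smul] at this
          exact hR.trans hγ this
        inv_mem' := by
          intro γ hγ
          have := hinv γ⁻¹ _ _ hγ
          rw [inv_smul_smul] at this
          exact hR.symm this }
    have hcH : c⁻¹ ∉ H := by
      intro h
      have := hinv c _ _ h
      rw [smul_inv_smul] at this
      exact hab (hR.trans hc this)
    obtain ⟨m, hm, h⟩ := Subgroup.exists_forall_mul_pow_notMem H hcH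
    refine ⟨m, hm, fun x hx => h x ?_⟩
    have := hinv c⁻¹ _ _ (hR.trans (hR.symm hc) hx)
    rw [inv_smul_smul, ← mul_smul] at this
    exact this
  · exact ⟨1, one_pos, fun x hx => hc ⟨_, hx⟩⟩

/-- Tuples in different orbits remain in different orbits modulo a suitable power. -/
lemma exists_forall_not_orbit_pow_smul {ι : Type*} [Finite ι] {a b : ι → Y}
    (hab : ¬ ∃ γ : G, ∀ k, γ • b k = a k) :
    ∃ m : ℕ, 0 < m ∧ ¬ ∃ γ : G, ∀ k, ∃ x : G, (γ * x ^ m) • b k = a k := by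
  by_cases hc : ∃ c : ι → G, ∀ k, c k • b k = a k
  · obtain ⟨c, hc⟩ := hc
    -- The tuples that act on `b` like a diagonal element; commutativity makes them a subgroup.
    -- Separating `c` from it in the finitely generated group `ι → G` allows a different `m`-th
    -- power at each coordinate.
    let H : Subgroup (ι → G) :=
      { carrier := {f | ∃ γ : G, ∀ k, f k • b k = γ • b k}
        one_mem' := ⟨1, fun k => by simp⟩
        mul_mem' := by
          rintro f f' ⟨γ, hγ⟩ ⟨δ, hδ⟩
          refine ⟨γ * δ, fun k => ?_⟩
          rw [Pi.mul_apply, mul_smul, hδ k, smul_comm, hγ k, smul_comm, ← mul_smul]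
        inv_mem' := by
          rintro f ⟨γ, hγ⟩
          refine ⟨γ⁻¹, fun k => ?_⟩
          rw [Pi.inv_apply, inv_smul_eq_iff, smul_comm, hγ k, inv_smul_smul] }
    have hcH : c ∉ H := by
      rintro ⟨γ, hγ⟩
      exact hab ⟨γ, fun k => by rw [← hγ k, hc k]⟩
    obtain ⟨m, hm, h⟩ := Subgroup.exists_forall_mul_pow_notMem H hcH
    refine ⟨m, hm, ?_⟩
    rintro ⟨γ, hγ⟩
    choose x hx using hγ
    refine h x⁻¹ ⟨γ, fun k => ?_⟩
    have h₁ : (c k * (x⁻¹ k) ^ m) • b k = (x k ^ m)⁻¹ • c k • b k := by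
      rw [← mul_smul, Pi.inv_apply, inv_pow, mul_comm]
    rw [Pi.mul_apply, Pi.pow_apply, h₁, hc k, inv_smul_eq_iff, ← hx k, ← mul_smul, mul_comm]
  · refine ⟨1, one_pos, ?_⟩
    rintro ⟨γ, hγ⟩
    choose x hx using hγ
    exact hc ⟨_, hx⟩

lemma exists_pos_forall_of_finite {ι : Type*} [Finite ι] {Q : ι → ℕ → Prop}
    (hQ : ∀ i m n, Q i m → Q i (m * n)) (h : ∀ i, ∃ m, 0 < m ∧ Q i m) :
    ∃ m, 0 < m ∧ ∀ i, Q i m := by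
  cases nonempty_fintype ι
  choose m hm hQm using h
  refine ⟨∏ i, m i, Finset.prod_pos fun i _ => hm i, fun i => ?_⟩
  obtain ⟨n, hn⟩ := Finset.dvd_prod_of_mem m (Finset.mem_univ i)
  rw [hn]
  exact hQ i _ n (hQm i)

end Separation

/-! ### Finite approximations of representations of abelian groups -/

section Approximation

/-- An automorphism as a permutation. -/
def Aut.toPerm (L : FirstOrder.Language) (M : Type*) [L.Structure M] : Aut L M →* Equiv.Perm M where
  toFun h := h.toEquiv
  map_one' := rfl
  map_mul' _ _ := rfl

variable {𝔘 : Tuple} {U : Type w} [𝔘.lang.Structure U] {Γ : Type*} [CommGroup Γ]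

/-- Points are equivalent if they differ by an `m`-th power. -/
def powSetoid (Γ : Type*) [CommGroup Γ] (Y : Type*) [MulAction Γ Y] (m : ℕ) : Setoid Y where
  r u v := ∃ x : Γ, x ^ m • u = v
  iseqv :=
    ⟨fun u => ⟨1, by simp⟩, fun {u v} ⟨x, hx⟩ => ⟨x⁻¹, by simp [← hx]⟩,
      fun {u v w} ⟨x, hx⟩ ⟨y, hy⟩ => ⟨y * x, by rw [mul_pow, mul_smul, hx, hy]⟩⟩

/-- The action on the classes modulo `m`-th powers. -/
@[reducible] def powQuotientAction (Γ : Type*) [CommGroup Γ] (Y : Type*) [MulAction Γ Y] (m : ℕ) :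
    MulAction Γ (Quotient (powSetoid Γ Y m)) where
  smul γ := Quotient.map (γ • ·) fun u v ⟨x, hx⟩ => ⟨x, by rw [smul_comm, hx]⟩
  one_smul q := by
    induction q using Quotient.inductionOn with
    | h u => exact congrArg _ (one_smul Γ u)
  mul_smul γ δ q := by
    induction q using Quotient.inductionOn with
    | h u => exact congrArg _ (mul_smul γ δ u)

/-- A representation of a finitely generated abelian group is approximated by partial
representations on finite sets. -/
lemma Rep.exists_isPartialRep [Group.FG Γ] [Countable U] (hU : 𝔘.IsRandomisedUltrametricSpace U)
    (θ : Rep 𝔘.lang U Γ) {A : Set U} (hA : A.Finite) {F : Set Γ} (hF : F.Finite) :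
    ∃ (B : Set U) (β : Γ →* Equiv.Perm U), IsPartialRep 𝔘 B β ∧ A ⊆ B ∧
      ∀ γ ∈ F, ∀ a ∈ A, β γ a = θ γ a := by
  have hUs := hU.isUStructure
  have hle := hUs.equivalence_relLe
  let : MulAction Γ U := MulAction.compHom U ((Aut.toPerm 𝔘.lang U).comp θ)
  have smul_def : ∀ (γ : Γ) (u : U), γ • u = θ γ u := fun _ _ => rfl
  have smul_le : ∀ t (γ : Γ) x y, 𝔘.relLe U t x y → 𝔘.relLe U t (γ • x) (γ • y) :=
    fun t γ x y => ((θ γ).relLe_iff t x y).2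
  have smul_P : ∀ i (γ : Γ) x, 𝔘.relP U i x → 𝔘.relP U i (fun k => γ • x k) :=
    fun i γ x => ((θ γ).relP_iff i x).2
  -- The images under `F` are included so that the action of `F` on `A` is still visible after `C`
  -- has been embedded.
  set C : Set U := A ∪ Set.image2 (fun γ a => θ γ a) F A with hC
  have hCfin : C.Finite := hA.union (hF.image2 _ hA)
  have := hCfin.to_subtype
  obtain ⟨D, hD⟩ := hUs.exists_hasDistances hCfin
  -- Three moduli follow: modulo `m₁`-th powers the points of `C` stay distinct, modulo `m₂`-th
  -- powers they come no closer, and modulo `m₃`-th powers tuples from `C` in different orbits stay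
  -- in different orbits. Each property passes to multiples, so a common multiple `m` has all three.
  obtain ⟨m₁, hm₁, h₁⟩ := exists_pos_forall_of_finite (ι := C × C)
    (Q := fun p m => p.1 ≠ p.2 → ∀ x : Γ, (p.1 : U) ≠ x ^ m • (p.2 : U))
    (fun p m n h hp x => by
      rw [mul_comm, pow_mul]
      exact h hp _)
    fun p => by
      by_cases hp : p.1 = p.2
      · exact ⟨1, one_pos, fun h => (h hp).elim⟩
      · obtain ⟨m, hm, h⟩ := exists_forall_not_rel_pow_smul (G := Γ) (R := fun x y : U => x = y)
          eq_equivalence (fun γ x y h => congrArg _ h) (a := p.1) (b := p.2)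
          fun h => hp (Subtype.ext h)
        exact ⟨m, hm, fun _ => h⟩
  obtain ⟨m₂, hm₂, h₂⟩ := exists_pos_forall_of_finite (ι := D × C × C)
    (Q := fun p m => ¬ 𝔘.relLe U p.1 p.2.1 p.2.2 →
      ∀ x : Γ, ¬ 𝔘.relLe U p.1 p.2.1 (x ^ m • (p.2.2 : U)))
    (fun p m n h hp x => by
      rw [mul_comm, pow_mul]
      exact h hp _)
    fun p => by
      by_cases hp : 𝔘.relLe U p.1 p.2.1 p.2.2
      · exact ⟨1, one_pos, fun h => (h hp).elim⟩
      · obtain ⟨m, hm, h⟩ := exists_forall_not_rel_pow_smul (G := Γ) (hle p.1)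
          (smul_le p.1) hp
        exact ⟨m, hm, fun _ => h⟩
  obtain ⟨m₃, hm₃, h₃⟩ := exists_pos_forall_of_finite
    (ι := Σ i : Fin 𝔘.r, (Fin (𝔘.arity i) → C) × (Fin (𝔘.arity i) → C))
    (Q := fun p m => (¬ ∃ γ : Γ, ∀ k, γ • (p.2.2 k : U) = p.2.1 k) →
      ¬ ∃ γ : Γ, ∀ k, ∃ x : Γ, (γ * x ^ m) • (p.2.2 k : U) = p.2.1 k)
    (fun p m n h hp ⟨γ, hγ⟩ => h hp ⟨γ, fun k => by
      obtain ⟨x, hx⟩ := hγ k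
      rw [mul_comm m, pow_mul] at hx
      exact ⟨_, hx⟩⟩)
    fun p => by
      by_cases hp : ∃ γ : Γ, ∀ k, γ • (p.2.2 k : U) = p.2.1 k
      · exact ⟨1, one_pos, fun h => (h hp).elim⟩
      · obtain ⟨m, hm, h⟩ := exists_forall_not_orbit_pow_smul hp
        exact ⟨m, hm, fun _ => h⟩
  obtain ⟨m, hm, n₁, n₂, n₃, e₁, e₂, e₃⟩ : ∃ m, 0 < m ∧ ∃ n₁ n₂ n₃, m = n₁ * m₁ ∧
      m = n₂ * m₂ ∧ m = n₃ * m₃ :=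
    ⟨m₁ * m₂ * m₃, by positivity, m₂ * m₃, m₁ * m₃, m₁ * m₂, by ring, by ring, by ring⟩
  have hne : ∀ a ∈ C, ∀ b ∈ C, ∀ x : Γ, a = x ^ m • b → a = b := by
    intro a ha b hb x hx
    by_contra hab
    rw [e₁, pow_mul] at hx
    exact h₁ (⟨a, ha⟩, ⟨b, hb⟩) (fun h => hab (congrArg Subtype.val h)) _ hx
  have hdist : ∀ t ∈ D, ∀ a ∈ C, ∀ b ∈ C, ∀ x : Γ, 𝔘.relLe U t a (x ^ m • b) →
      𝔘.relLe U t a b := by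
    intro t ht a ha b hb x hx
    by_contra hab
    rw [e₂, pow_mul] at hx
    exact h₂ (⟨t, ht⟩, ⟨a, ha⟩, ⟨b, hb⟩) hab _ hx
  have htup : ∀ i (a b : Fin (𝔘.arity i) → U), (∀ k, a k ∈ C) → (∀ k, b k ∈ C) →
      (∃ γ : Γ, ∀ k, ∃ x : Γ, (γ * x ^ m) • b k = a k) → ∃ γ : Γ, ∀ k, γ • b k = a k := by
    rintro i a b ha hb ⟨γ, hγ⟩
    by_contra hab
    refine h₃ ⟨i, fun k => ⟨a k, ha k⟩, fun k => ⟨b k, hb k⟩⟩ hab ⟨γ, fun k => ?_⟩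
    obtain ⟨x, hx⟩ := hγ k
    rw [e₃, pow_mul] at hx
    exact ⟨_, hx⟩
  let X := Quotient (powSetoid Γ U m)
  let mk : U → X := Quotient.mk (powSetoid Γ U m)
  have mk_eq : ∀ {u v}, mk u = mk v → ∃ x : Γ, x ^ m • u = v := fun h => Quotient.exact h
  have mk_smul : ∀ (x : Γ) u, mk (x ^ m • u) = mk u := fun x u =>
    (Quotient.sound (s := powSetoid Γ U m) ⟨x, rfl⟩).symm
  have mk_surj : ∀ p : X, ∃ u, mk u = p := Quotient.exists_rep
  let α : Γ →* Equiv.Perm X := @MulAction.toPermHom Γ X _ (powQuotientAction Γ U m)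
  have α_mk : ∀ γ u, α γ (mk u) = mk (γ • u) := fun _ _ => rfl
  let R : 𝔘.S → X → X → Prop := fun t p q => ∃ u v, mk u = p ∧ mk v = q ∧ 𝔘.relLe U t u v
  -- Only translates of tuples from `C` are used: an arbitrary tuple in `P i` could have two entries
  -- in the same class, against distinctness.
  let P : ∀ i : Fin 𝔘.r, (Fin (𝔘.arity i) → X) → Prop := fun i p =>
    ∃ (γ : Γ) (a : Fin (𝔘.arity i) → U), (∀ k, a k ∈ C) ∧ 𝔘.relP U i a ∧
      p = fun k => mk (γ • a k)
  have mk_inj : ∀ γ : Γ, ∀ a ∈ C, ∀ b ∈ C, mk (γ • a) = mk (γ • b) → a = b := by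
    intro γ a ha b hb h
    obtain ⟨x, hx⟩ := mk_eq h
    rw [smul_comm] at hx
    exact (hne b hb a ha x (smul_left_cancel γ hx).symm).symm
  have hX : @Tuple.IsUStructure 𝔘 X (Tuple.mkStructure D R P) := by
    refine Tuple.isUStructure_mkStructure hD.nonempty (fun t => ⟨fun p => ?_, ?_, ?_⟩) ?_ ?_ ?_
    · obtain ⟨u, rfl⟩ := mk_surj p
      exact ⟨u, u, rfl, rfl, (hle t).refl u⟩
    · rintro _ _ ⟨u, v, rfl, rfl, h⟩
      exact ⟨v, u, rfl, rfl, (hle t).symm h⟩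
    · rintro _ _ _ ⟨u, v, rfl, rfl, h⟩ ⟨v', w, hv, rfl, h'⟩
      obtain ⟨x, rfl⟩ := mk_eq hv
      exact ⟨u, x ^ m • w, rfl, mk_smul x w, (hle t).trans h (smul_le t _ _ _ h')⟩
    · rintro t t' htt' _ _ ⟨u, v, rfl, rfl, h⟩
      exact ⟨u, v, rfl, rfl, Tuple.relLe_mono htt' h⟩
    · rintro i ϑ hϑ _ ⟨γ, a, ha, hP, rfl⟩
      exact ⟨γ, a ∘ ϑ, fun k => ha _, (hUs.symm_P i ϑ hϑ a).2 hP, rfl⟩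
    · rintro i _ ⟨γ, a, ha, hP, rfl⟩ k l hkl
      exact hUs.distinct_P i a hP (mk_inj γ _ (ha k) _ (ha l) hkl)
  let Z : Set X := {p | ∃ γ : Γ, ∃ c ∈ C, p = mk (γ • c)}
  have hZ : Z.Finite := by
    have := finite_quotient_range_pow (G := Γ) hm
    -- A class `mk (γ • c)` depends only on `c` and on `γ` modulo `m`-th powers, and that quotient
    -- of `Γ` is finite.
    refine (Set.finite_univ.image2
      (fun (q : Γ ⧸ (powMonoidHom m : Γ →* Γ).range) c => mk (q.out • c)) hCfin).subset ?_
    rintro _ ⟨γ, c, hc, rfl⟩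
    refine ⟨(γ : Γ ⧸ (powMonoidHom m : Γ →* Γ).range), trivial, c, hc, ?_⟩
    obtain ⟨⟨_, x, rfl⟩, hx⟩ :=
      QuotientGroup.mk_out_eq_mul (powMonoidHom m : Γ →* Γ).range γ
    change mk ((γ : Γ ⧸ (powMonoidHom m : Γ →* Γ).range).out • c) = _
    rw [hx, mul_comm, mul_smul]
    exact mk_smul x _
  have hαZ : ∀ γ, Set.MapsTo (α γ) Z Z := by
    rintro γ _ ⟨δ, c, hc, rfl⟩
    exact ⟨γ * δ, c, hc, by rw [α_mk, mul_smul]⟩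
  have hαinv : ∀ γ p, α γ⁻¹ (α γ p) = p := fun γ p => by simp
  have R1 : ∀ γ t p q, R t p q → R t (α γ p) (α γ q) := by
    rintro γ t _ _ ⟨u, v, rfl, rfl, h⟩
    exact ⟨_, _, rfl, rfl, smul_le t γ _ _ h⟩
  have P1 : ∀ γ i p, P i p → P i (α γ ∘ p) := by
    rintro γ i _ ⟨δ, a, ha, hP, rfl⟩
    refine ⟨γ * δ, a, ha, hP, funext fun k => ?_⟩
    change α γ (mk _) = _
    rw [α_mk, mul_smul]
  let := Tuple.mkStructure D R P
  have hα : ∀ γ, 𝔘.IsEmbOn Z (α γ) := by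
    refine fun γ => Tuple.isEmbOn_mkStructure_self (α γ).injective.injOn
      (fun t p _ q _ => ⟨fun h => ?_, R1 γ t p q⟩) fun i p _ => ⟨fun h => ?_, P1 γ i p⟩
    · simpa only [hαinv] using R1 γ⁻¹ t _ _ h
    · have := P1 γ⁻¹ i _ h
      have e : α γ⁻¹ ∘ (α γ ∘ p) = p := funext fun k => hαinv γ _
      rwa [e] at this
  have hj : 𝔘.IsEmbOn C mk := by
    refine Tuple.isEmbOn_mkStructure hUs hD (fun a ha b hb h => ?_) (fun t ht a ha b hb =>
      ⟨?_, fun h => ⟨a, b, rfl, rfl, h⟩⟩) fun i x hx => ⟨?_, fun h => ?_⟩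
    · exact mk_inj 1 a ha b hb (by simpa using h)
    · rintro ⟨u, v, hu, hv, h⟩
      obtain ⟨y, rfl⟩ := mk_eq hu
      obtain ⟨z, rfl⟩ := mk_eq hv
      refine hdist t ht _ ha _ hb (y * z⁻¹) ?_
      rw [mul_pow, mul_smul, inv_pow, inv_smul_smul]
      exact smul_le t _ _ _ h
    · rintro ⟨γ, a, ha, hP, h⟩
      obtain ⟨δ, hδ⟩ := htup i x a hx ha ⟨γ, fun k => by
        obtain ⟨y, hy⟩ := mk_eq (congrFun h k).symm
        exact ⟨y, by rw [mul_comm, mul_smul, hy]⟩⟩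
      have : x = fun k => δ • a k := funext fun k => (hδ k).symm
      rw [this]
      exact smul_P i δ a hP
    · exact ⟨1, x, hx, h, funext fun k => by rw [one_smul]; rfl⟩
  have hjZ : Set.MapsTo mk C Z := fun c hc => ⟨1, c, hc, by rw [one_smul]⟩
  obtain ⟨B, β, e, hβ, -, heZ, hej, heα⟩ := hU.exists_isPartialRep hX hZ α hαZ hα hCfin hj hjZ
  refine ⟨B, β, hβ, fun a ha => ?_, fun γ hγ a ha => ?_⟩
  · rw [← hej a (Or.inl ha)]
    exact heZ (hjZ (Or.inl ha))
  · have := heα γ _ (hjZ (Or.inl ha))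
    rw [hej a (Or.inl ha), α_mk, hej (γ • a) (Or.inr ⟨γ, hγ, a, ha, rfl⟩)] at this
    exact this.symm

end Approximation

/-! ### Limits of chains -/

section Chains

/-- Dependent choice along an enumeration of a countable type. -/
lemma exists_chain {σ U : Type*} [Countable U] {r : σ → σ → Prop} {p : U → σ → Prop}
    (hrefl : ∀ s, r s s) (htrans : ∀ s t v, r s t → r t v → r s v)
    (hstep : ∀ s u, ∃ t, r s t ∧ p u t) (s₀ : σ) :
    ∃ s : ℕ → σ, s 0 = s₀ ∧ (∀ m n, m ≤ n → r (s m) (s n)) ∧ ∀ u, ∃ n, p u (s n) := by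
  rcases isEmpty_or_nonempty U with h | h
  · exact ⟨fun _ => s₀, rfl, fun _ _ _ => hrefl _, isEmptyElim⟩
  obtain ⟨f, hf⟩ := exists_surjective_nat U
  choose next hr hp using hstep
  let s : ℕ → σ := fun n => Nat.rec s₀ (fun k t => next t (f k)) n
  have hs : ∀ n, s (n + 1) = next (s n) (f n) := fun _ => rfl
  refine ⟨s, rfl, fun m n hmn => ?_, fun u => ?_⟩
  · induction n, hmn using Nat.le_induction with
    | base => exact hrefl _
    | succ n _ ih => exact htrans _ _ _ ih (by rw [hs]; exact hr _ _)
  · obtain ⟨n, rfl⟩ := hf u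
    exact ⟨n + 1, by rw [hs]; exact hp _ _⟩

variable {𝔘 : Tuple} {U : Type w} [𝔘.lang.Structure U]

/-- Automorphisms that agree on an increasing exhaustion converge to an automorphism. -/
lemma exists_limit_aut (A : ℕ → Set U) (hA : ∀ m n, m ≤ n → A m ⊆ A n) (hAU : ∀ u, ∃ n, u ∈ A n)
    (h : ℕ → Aut 𝔘.lang U) (hh : ∀ m n, m ≤ n → ∀ a ∈ A m, h n a = h m a)
    (hsurj : ∀ u, ∃ n, ∃ a ∈ A n, h n a = u) :
    ∃ g : Aut 𝔘.lang U, ∀ n, ∀ a ∈ A n, g a = h n a := by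
  choose N hN using hAU
  let f : U → U := fun u => h (N u) u
  have hf : ∀ n, ∀ a ∈ A n, f a = h n a := by
    intro n a ha
    rw [← hh n (max n (N a)) (le_max_left _ _) a ha,
      hh (N a) (max n (N a)) (le_max_right _ _) a (hN a)]
  have hbij : Function.Bijective f := by
    refine ⟨fun a b hab => ?_, fun u => ?_⟩
    · rw [hf _ a (hA _ _ (le_max_left (N a) (N b)) (hN a)),
        hf _ b (hA _ _ (le_max_right (N a) (N b)) (hN b))] at hab
      exact (h _).injective hab
    · obtain ⟨n, a, ha, rfl⟩ := hsurj u
      exact ⟨a, hf n a ha⟩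
  refine ⟨⟨Equiv.ofBijective f hbij, fun {n} F => (inferInstance :
    IsEmpty (𝔘.lang.Functions n)).elim F, fun {n} R x => ?_⟩, hf⟩
  let M := Finset.univ.sup fun k => N (x k)
  have hM : ∀ k, x k ∈ A M := fun k =>
    hA _ _ (Finset.le_sup (f := fun k => N (x k)) (Finset.mem_univ k)) (hN (x k))
  have : f ∘ x = h M ∘ x := funext fun k => hf M _ (hM k)
  change Structure.RelMap R (f ∘ x) ↔ _
  rw [this]
  exact (h M).map_rel R x

variable [Countable U] {Γ : Type*} [Group Γ]

/-- Every partial representation extends to a representation. -/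
lemma IsPartialRep.exists_rep (hU : 𝔘.IsRandomisedUltrametricSpace U) {B : Set U}
    {β : Γ →* Equiv.Perm U} (hβ : IsPartialRep 𝔘 B β) :
    ∃ θ : Rep 𝔘.lang U Γ, ∀ γ, ∀ b ∈ B, θ γ b = β γ b := by
  obtain ⟨s, hs₀, hs, hsU⟩ := exists_chain
    (σ := {p : Set U × (Γ →* Equiv.Perm U) // IsPartialRep 𝔘 p.1 p.2})
    (r := fun p q => p.1.1 ⊆ q.1.1 ∧ ∀ γ, ∀ b ∈ p.1.1, q.1.2 γ b = p.1.2 γ b)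
    (p := fun u p => u ∈ p.1.1)
    (fun p => ⟨subset_rfl, fun _ _ _ => rfl⟩)
    (fun p q v h h' => ⟨h.1.trans h'.1, fun γ b hb => (h'.2 γ b (h.1 hb)).trans (h.2 γ b hb)⟩)
    (fun p u => by
      obtain ⟨B', β', h, hB, hu, hβ'⟩ := p.2.exists_extension hU u
      exact ⟨⟨(B', β'), h⟩, ⟨hB, hβ'⟩, hu⟩)
    ⟨(B, β), hβ⟩
  have key : ∀ γ, ∃ g : Aut 𝔘.lang U, ∀ n, ∀ b ∈ (s n).1.1, g b = (s n).1.2 γ b := by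
    intro γ
    choose h hh using fun n => (s n).2.exists_aut γ
    obtain ⟨g, hg⟩ := exists_limit_aut (fun n => (s n).1.1) (fun m n hmn => (hs m n hmn).1) hsU h
      (fun m n hmn a ha => by
        rw [hh n a ((hs m n hmn).1 ha), hh m a ha, (hs m n hmn).2 γ a ha])
      (fun u => by
        obtain ⟨n, hn⟩ := hsU u
        have hn' := (s n).2.mapsTo γ⁻¹ hn
        exact ⟨n, _, hn', by rw [hh n _ hn']; simp⟩)
    exact ⟨g, fun n b hb => (hg n b hb).trans (hh n b hb)⟩
  choose g hg using key
  refine ⟨⟨⟨g, ?_⟩, fun γ δ => ?_⟩, fun γ b hb => ?_⟩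
  · ext u
    obtain ⟨n, hn⟩ := hsU u
    rw [hg 1 n u hn, map_one]
    rfl
  · ext u
    obtain ⟨n, hn⟩ := hsU u
    change g (γ * δ) u = g γ (g δ u)
    rw [hg _ n u hn, hg δ n u hn, hg γ n _ ((s n).2.mapsTo δ hn), map_mul]
    rfl
  · have h0 : (s 0).1 = (B, β) := congrArg Subtype.val hs₀
    have := hg γ 0 b (by rw [h0]; exact hb)
    rw [h0] at this
    exact this

end Chains

/-! ### The topology of the space of representations -/

section Topology

open Topology

variable {L : FirstOrder.Language} {M : Type*} [L.Structure M] {Γ : Type*} [Group Γ]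

/-- Evaluation of a representation at all points. -/
def Rep.eval (θ : Rep L M Γ) (p : Γ × M) : M :=
  θ p.1 p.2

lemma Rep.isInducing_eval [TopologicalSpace M] [DiscreteTopology M] :
    IsInducing (Rep.eval : Rep L M Γ → Γ × M → M) := by
  refine ⟨?_⟩
  have hM : ‹TopologicalSpace M› = ⊥ := DiscreteTopology.eq_bot
  subst hM
  simp only [Rep.instTopologicalSpace, Aut.instTopologicalSpace, Pi.topologicalSpace,
    induced_iInf, induced_compose, iInf_prod]
  rfl

lemma Rep.exists_agree_subset {O : Set (Rep L M Γ)} (hO : IsOpen O) {θ : Rep L M Γ} (hθ : θ ∈ O) :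
    ∃ (F : Set Γ) (A : Set M), F.Finite ∧ A.Finite ∧
      ∀ θ' : Rep L M Γ, (∀ γ ∈ F, ∀ a ∈ A, θ' γ a = θ γ a) → θ' ∈ O := by
  classical
  let : TopologicalSpace M := ⊥
  have : DiscreteTopology M := ⟨rfl⟩
  obtain ⟨V, hV, rfl⟩ := Rep.isInducing_eval.isOpen_iff.1 hO
  obtain ⟨I, v, hv, hIV⟩ := isOpen_pi_iff.1 hV _ hθ
  refine ⟨I.image Prod.fst, I.image Prod.snd, Finset.finite_toSet _, Finset.finite_toSet _,
    fun θ' h => hIV fun p hp => ?_⟩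
  have : θ'.eval p = θ.eval p :=
    h p.1 (by simpa using ⟨p.2, hp⟩) p.2 (by simpa using ⟨p.1, hp⟩)
  rw [this]
  exact (hv p hp).2

lemma Rep.isClopen_setOf_apply_eq (γ : Γ) (a b : M) : IsClopen {θ : Rep L M Γ | θ γ a = b} := by
  let : TopologicalSpace M := ⊥
  have : DiscreteTopology M := ⟨rfl⟩
  have hc : Continuous fun θ : Rep L M Γ => θ.eval (γ, a) :=
    (continuous_apply (γ, a)).comp Rep.isInducing_eval.continuous
  exact (isClopen_discrete {b}).preimage hc

lemma countable_of_group_fg [Group.FG Γ] : Countable Γ := by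
  obtain ⟨α, _, φ, hφ⟩ := Monoid.fg_iff_exists_freeGroup_hom_surjective_finite.1
    (Group.fg_iff_monoid_fg.1 ‹Group.FG Γ›)
  have : Countable (FreeMonoid α) := inferInstanceAs (Countable (List α))
  exact hφ.countable

/-- Each condition depends on finitely many coordinates. Bijectivity, which is not a closed
condition, comes for free from the action laws, with `f (γ⁻¹, ·)` as inverse. -/
lemma Rep.isClosed_range_eval [TopologicalSpace M] [DiscreteTopology M] :
    IsClosed (Set.range (Rep.eval : Rep L M Γ → Γ × M → M)) := by
  have : Set.range (Rep.eval : Rep L M Γ → Γ × M → M) =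
      -- Naming the value `v` avoids a coordinate that depends on `f`.
      (⋂ u, {f | f (1, u) = u}) ∩ (⋂ γ, ⋂ δ, ⋂ u, ⋂ v, {f | f (δ, u) = v → f (γ * δ, u) = f (γ, v)}) ∩
      ((⋂ n, ⋂ F : L.Functions n, ⋂ γ, ⋂ x : Fin n → M,
        {f | f (γ, Structure.funMap F x) = Structure.funMap F fun k => f (γ, x k)}) ∩
      ⋂ n, ⋂ R : L.Relations n, ⋂ γ, ⋂ x : Fin n → M,
        {f | Structure.RelMap R (fun k => f (γ, x k)) ↔ Structure.RelMap R x}) := by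
    ext f
    simp only [Set.mem_range, Set.mem_inter_iff, Set.mem_iInter, Set.mem_ofPred_eq]
    constructor
    · rintro ⟨θ, rfl⟩
      refine ⟨⟨fun u => ?_, ?_⟩, fun n F γ x => (θ γ).map_fun F x, fun n R γ x => (θ γ).map_rel R x⟩
      · change θ 1 u = u
        rw [map_one]
        rfl
      · rintro γ δ u _ rfl
        change θ (γ * δ) u = θ γ (θ δ u)
        rw [map_mul]
        rfl
    · rintro ⟨⟨h1, hmul⟩, hF, hR⟩
      have hm : ∀ γ δ u, f (γ, f (δ, u)) = f (γ * δ, u) := fun γ δ u => (hmul γ δ u _ rfl).symm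
      refine ⟨⟨⟨fun γ => ⟨⟨fun u => f (γ, u), fun u => f (γ⁻¹, u), fun u => ?_, fun u => ?_⟩,
        fun F x => hF _ F γ x, fun R x => hR _ R γ x⟩, ?_⟩, fun γ δ => ?_⟩, rfl⟩
      · exact (hm γ⁻¹ γ u).trans (by rw [inv_mul_cancel, h1])
      · exact (hm γ γ⁻¹ u).trans (by rw [mul_inv_cancel, h1])
      · ext u
        exact h1 u
      · ext u
        exact (hm γ δ u).symm
  rw [this]
  have hfin : ∀ n, ∀ γ : Γ, ∀ x : Fin n → M, Continuous fun (f : Γ × M → M) k => f (γ, x k) :=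
    fun n γ x => continuous_pi fun k => continuous_apply _
  refine ((isClosed_iInter fun u => ?_).inter (isClosed_iInter fun γ => isClosed_iInter fun δ =>
    isClosed_iInter fun u => isClosed_iInter fun v => ?_)).inter
    ((isClosed_iInter fun n => isClosed_iInter fun F => isClosed_iInter fun γ =>
      isClosed_iInter fun x => ?_).inter (isClosed_iInter fun n => isClosed_iInter fun R =>
        isClosed_iInter fun γ => isClosed_iInter fun x => ?_))
  · exact isClosed_eq (continuous_apply _) continuous_const
  · have hc : Continuous fun f : Γ × M → M => (f (δ, u), f (γ * δ, u), f (γ, v)) := by fun_prop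
    exact (isClosed_discrete {p : M × M × M | p.1 = v → p.2.1 = p.2.2}).preimage hc
  · exact isClosed_eq (continuous_apply _)
      ((continuous_of_discreteTopology (f := fun y : Fin n → M => Structure.funMap F y)).comp
        (hfin n γ x))
  · exact (isClosed_discrete {y : Fin n → M | Structure.RelMap R y ↔ Structure.RelMap R x}).preimage
      (hfin n γ x)

lemma Rep.baireSpace [Countable M] [Countable Γ] : BaireSpace (Rep L M Γ) := by
  let : TopologicalSpace M := ⊥
  have : DiscreteTopology M := ⟨rfl⟩
  have hinj : Function.Injective (Rep.eval : Rep L M Γ → Γ × M → M) := by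
    intro θ θ' h
    ext γ u
    exact congrFun h (γ, u)
  have : IsClosedEmbedding (Rep.eval : Rep L M Γ → Γ × M → M) :=
    ⟨⟨Rep.isInducing_eval, hinj⟩, Rep.isClosed_range_eval⟩
  have := this.IsCompletelyMetrizableSpace
  infer_instance

end Topology

/-! ### Generic representations -/

section Generic

variable {𝔘 : Tuple} {U : Type w} [𝔘.lang.Structure U] {Γ : Type*} [Group Γ]

/-- All orbits of the representation are finite. -/
def Rep.FiniteOrbits (θ : Rep 𝔘.lang U Γ) : Prop :=
  ∀ u, (θ.orbit u).Finite

/-- The partial representation `β` on `B` is realised in `θ` over `A`, if the two agree there. -/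
def Rep.Realises (θ : Rep 𝔘.lang U Γ) (A B : Set U) (β : Γ →* Equiv.Perm U) : Prop :=
  (∀ γ, ∀ a ∈ A, θ γ a = β γ a) →
    ∃ g : U → U, 𝔘.IsEmbOn B g ∧ (∀ a ∈ A, g a = a) ∧ ∀ γ, ∀ b ∈ B, θ γ (g b) = g (β γ b)

/-- Every partial representation is realised over every invariant subset. -/
def Rep.Saturated (θ : Rep 𝔘.lang U Γ) : Prop :=
  ∀ A B : Set U, ∀ β : Γ →* Equiv.Perm U, IsPartialRep 𝔘 B β → A ⊆ B →
    (∀ γ, Set.MapsTo (β γ) A A) → θ.Realises A B β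

lemma Rep.mapsTo_orbit (θ : Rep 𝔘.lang U Γ) (u : U) (γ : Γ) :
    Set.MapsTo (θ γ) (θ.orbit u) (θ.orbit u) := by
  rintro _ ⟨δ, rfl⟩
  refine ⟨γ * δ, ?_⟩
  change θ (γ * δ) u = _
  rw [map_mul]
  rfl

lemma Rep.mem_orbit_self (θ : Rep 𝔘.lang U Γ) (u : U) : u ∈ θ.orbit u := by
  refine ⟨1, ?_⟩
  change θ 1 u = _
  rw [map_one]
  rfl

/-- Actions agree on an invariant set if they agree for generators. -/
lemma eq_on_of_closure_eq_top {T : Set Γ} (hT : Subgroup.closure T = ⊤) {Y : Type*}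
    {η β : Γ →* Equiv.Perm Y} {A : Set Y} (hA : ∀ γ, Set.MapsTo (β γ) A A)
    (h : ∀ γ ∈ T, ∀ a ∈ A, η γ a = β γ a) (γ : Γ) : ∀ a ∈ A, η γ a = β γ a := by
  have hγ : γ ∈ Subgroup.closure T := hT ▸ Subgroup.mem_top γ
  induction hγ using Subgroup.closure_induction with
  | mem γ hγ => exact h γ hγ
  | one => simp
  | mul γ δ _ _ hγ hδ =>
    intro a ha
    rw [map_mul, map_mul, Equiv.Perm.mul_apply, Equiv.Perm.mul_apply, hδ a ha,
      hγ _ (hA δ ha)]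
  | inv γ _ hγ =>
    intro a ha
    have := hγ _ (hA γ⁻¹ ha)
    have e : β γ (β γ⁻¹ a) = a := by simp
    rw [e] at this
    rw [map_inv, Equiv.Perm.inv_eq_iff_eq, this]

/-- As `A` is invariant, agreement need only be tested for finitely many generators. -/
lemma Rep.isOpen_setOf_agree [Group.FG Γ] (β : Γ →* Equiv.Perm U) {A : Set U} (hA : A.Finite)
    (hβ : ∀ γ, Set.MapsTo (β γ) A A) :
    IsOpen {θ : Rep 𝔘.lang U Γ | ∀ γ, ∀ a ∈ A, θ γ a = β γ a} := by
  obtain ⟨T, hT⟩ := (Group.FG.out : (⊤ : Subgroup Γ).FG)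
  have : {θ : Rep 𝔘.lang U Γ | ∀ γ, ∀ a ∈ A, θ γ a = β γ a} =
      ⋂ γ ∈ T, ⋂ a ∈ A, {θ | θ γ a = β γ a} := by
    ext θ
    simp only [Set.mem_iInter]
    exact ⟨fun h γ _ a ha => h γ a ha, fun h =>
      eq_on_of_closure_eq_top hT (η := (Aut.toPerm 𝔘.lang U).comp θ) hβ h⟩
  rw [this]
  exact isOpen_biInter_finset fun γ _ => hA.isOpen_biInter fun a _ =>
    (Rep.isClopen_setOf_apply_eq γ a _).isOpen

lemma Rep.isClosed_setOf_agree (β : Γ →* Equiv.Perm U) (A : Set U) :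
    IsClosed {θ : Rep 𝔘.lang U Γ | ∀ γ, ∀ a ∈ A, θ γ a = β γ a} := by
  have : {θ : Rep 𝔘.lang U Γ | ∀ γ, ∀ a ∈ A, θ γ a = β γ a} =
      ⋂ γ, ⋂ a ∈ A, {θ | θ γ a = β γ a} := by
    ext θ
    simp only [Set.mem_iInter]
    exact Iff.rfl
  rw [this]
  exact isClosed_iInter fun γ => isClosed_biInter fun a _ =>
    (Rep.isClopen_setOf_apply_eq γ a _).isClosed

lemma Rep.isOpen_setOf_finite_orbit [Group.FG Γ] (u : U) :
    IsOpen {θ : Rep 𝔘.lang U Γ | (θ.orbit u).Finite} := by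
  refine isOpen_iff_forall_mem_open.2 fun θ hθ => ⟨_, ?_,
    Rep.isOpen_setOf_agree ((Aut.toPerm 𝔘.lang U).comp θ) hθ (θ.mapsTo_orbit u),
    fun γ a _ => rfl⟩
  intro θ' h
  refine Set.Finite.subset hθ ?_
  rintro _ ⟨γ, rfl⟩
  exact ⟨γ, (h γ u (θ.mem_orbit_self u)).symm⟩

/-- A realisation `g` persists in all representations that agree on the finite invariant set `g ''
B`. Where the premise fails, it fails on an open set. -/
lemma Rep.isOpen_setOf_realises [Group.FG Γ] {A B : Set U} {β : Γ →* Equiv.Perm U}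
    (hβ : IsPartialRep 𝔘 B β) : IsOpen {θ : Rep 𝔘.lang U Γ | θ.Realises A B β} := by
  refine isOpen_iff_forall_mem_open.2 fun θ hθ => ?_
  by_cases h : ∀ γ, ∀ a ∈ A, θ γ a = β γ a
  · obtain ⟨g, hg, hgA, hgB⟩ := hθ h
    refine ⟨_, ?_, Rep.isOpen_setOf_agree ((Aut.toPerm 𝔘.lang U).comp θ) (hβ.finite.image g) ?_,
      fun γ a _ => rfl⟩
    · intro θ' h' _
      refine ⟨g, hg, hgA, fun γ b hb => ?_⟩
      rw [← hgB γ b hb]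
      exact h' γ _ ⟨b, hb, rfl⟩
    · rintro γ _ ⟨b, hb, rfl⟩
      exact ⟨_, hβ.mapsTo γ hb, (hgB γ b hb).symm⟩
  · exact ⟨_, fun θ' h' hA => (h' hA).elim, (Rep.isClosed_setOf_agree β A).isOpen_compl, h⟩

lemma IsPartialRep.countable [Group.FG Γ] (B : Set U) (hB : B.Finite) :
    {β : Γ →* Equiv.Perm U | IsPartialRep 𝔘 B β}.Countable := by
  obtain ⟨T, hT⟩ := (Group.FG.out : (⊤ : Subgroup Γ).FG)
  have := hB.to_subtype
  let f : {β : Γ →* Equiv.Perm U | IsPartialRep 𝔘 B β} → T → B → B := fun β t b =>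
    ⟨β.1 t b, β.2.mapsTo t b.2⟩
  have hf : Function.Injective f := by
    rintro ⟨β, hβ⟩ ⟨η, hη⟩ h
    refine Subtype.ext (MonoidHom.ext fun γ => Equiv.ext fun u => ?_)
    by_cases hu : u ∈ B
    · refine eq_on_of_closure_eq_top hT hη.mapsTo (fun t ht b hb => ?_) γ u hu
      exact congrArg Subtype.val (congrFun (congrFun h ⟨t, ht⟩) ⟨b, hb⟩)
    · exact (hβ.eq_self γ u hu).trans (hη.eq_self γ u hu).symm
  exact Set.countable_coe_iff.1 hf.countable

end Generic

/-! ### Comeagreness of finite orbits and of saturation -/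

section Dense

variable {𝔘 : Tuple} {U : Type w} [𝔘.lang.Structure U] [Countable U] {Γ : Type*} [CommGroup Γ]
  [Group.FG Γ]

/-- A finite approximation whose domain contains `u` extends to a representation, in which the orbit
of `u` stays in that domain. -/
lemma Rep.dense_setOf_finite_orbit (hU : 𝔘.IsRandomisedUltrametricSpace U) (u : U) :
    Dense {θ : Rep 𝔘.lang U Γ | (θ.orbit u).Finite} := by
  refine dense_iff_inter_open.2 fun O hO ⟨θ, hθ⟩ => ?_
  obtain ⟨F, A, hF, hA, h⟩ := Rep.exists_agree_subset hO hθ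
  obtain ⟨B, β, hβ, hAB, hβθ⟩ := θ.exists_isPartialRep hU (hA.insert u) hF
  obtain ⟨θ', hθ'⟩ := hβ.exists_rep hU
  refine ⟨θ', h θ' fun γ hγ a ha => ?_, hβ.finite.subset ?_⟩
  · rw [hθ' γ a (hAB (Or.inr ha)), hβθ γ hγ a (Or.inr ha)]
  · rintro _ ⟨γ, rfl⟩
    have hu : u ∈ B := hAB (Or.inl rfl)
    change θ' γ u ∈ B
    rw [hθ' γ u hu]
    exact hβ.mapsTo γ hu

lemma Rep.dense_setOf_realises (hU : 𝔘.IsRandomisedUltrametricSpace U) {A B : Set U}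
    {β : Γ →* Equiv.Perm U} (hβ : IsPartialRep 𝔘 B β) (hAB : A ⊆ B)
    (hA : ∀ γ, Set.MapsTo (β γ) A A) : Dense {θ : Rep 𝔘.lang U Γ | θ.Realises A B β} := by
  refine dense_iff_inter_open.2 fun O hO ⟨θ, hθ⟩ => ?_
  by_cases hθβ : ∀ γ, ∀ a ∈ A, θ γ a = β γ a
  · obtain ⟨T, hT⟩ := (Group.FG.out : (⊤ : Subgroup Γ).FG)
    obtain ⟨F, E, hF, hE, h⟩ := Rep.exists_agree_subset hO hθ
    -- The approximation also copies `θ` on `A` for the generators `T`, so that it agrees with `β`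
    -- on `A` and can be amalgamated with it.
    obtain ⟨C, η, hη, hC, hηθ⟩ := θ.exists_isPartialRep hU (hE.union (hβ.finite.subset hAB))
      (hF.union T.finite_toSet)
    have hηβ : ∀ γ, ∀ a ∈ A, η γ a = β γ a :=
      eq_on_of_closure_eq_top hT hA fun γ hγ a ha => by
        rw [hηθ γ (Or.inr hγ) a (Or.inr ha), hθβ γ a ha]
    obtain ⟨C', η', g, hη', hCC', hη'η, hg, hgC', hgA, hgB⟩ :=
      hβ.exists_amalgam hU hη hAB (Set.subset_union_right.trans hC) hA hηβ
    obtain ⟨θ', hθ'⟩ := hη'.exists_rep hU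
    refine ⟨θ', h θ' fun γ hγ a ha => ?_, fun _ => ⟨g, hg, hgA, fun γ b hb => ?_⟩⟩
    · have haC : a ∈ C := hC (Or.inl ha)
      rw [hθ' γ a (hCC' haC), hη'η γ a haC, hηθ γ (Or.inl hγ) a (Or.inl ha)]
    · rw [hθ' γ _ (hgC' hb), hgB γ b hb]
  · exact ⟨θ, hθ, fun h => (hθβ h).elim⟩

lemma Rep.finiteOrbits_mem_residual (hU : 𝔘.IsRandomisedUltrametricSpace U) :
    {θ : Rep 𝔘.lang U Γ | θ.FiniteOrbits} ∈ residual (Rep 𝔘.lang U Γ) :=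
  eventually_countable_forall.2 fun u =>
    residual_of_dense_open (Rep.isOpen_setOf_finite_orbit u) (Rep.dense_setOf_finite_orbit hU u)

lemma Rep.saturated_mem_residual (hU : 𝔘.IsRandomisedUltrametricSpace U) :
    {θ : Rep 𝔘.lang U Γ | θ.Saturated} ∈ residual (Rep 𝔘.lang U Γ) := by
  have (B : Finset U) : Countable {β : Γ →* Equiv.Perm U | IsPartialRep 𝔘 (B : Set U) β} :=
    (IsPartialRep.countable _ B.finite_toSet).to_subtype
  have h : ∀ᶠ θ in residual (Rep 𝔘.lang U Γ), ∀ A B : Finset U,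
      ∀ β : {β : Γ →* Equiv.Perm U | IsPartialRep 𝔘 (B : Set U) β},
      (A : Set U) ⊆ B → (∀ γ, Set.MapsTo (β.1 γ) A A) → θ.Realises A B β.1 := by
    simp only [eventually_countable_forall]
    intro A B β hAB hA
    exact residual_of_dense_open (Rep.isOpen_setOf_realises β.2)
      (Rep.dense_setOf_realises hU β.2 hAB hA)
  filter_upwards [h] with θ hθ A B β hβ hAB hA
  have := hθ (hβ.finite.subset hAB).toFinset hβ.finite.toFinset ⟨β, by simpa using hβ⟩
  simp only [Set.Finite.coe_toFinset] at this
  exact this hAB hA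

end Dense

/-! ### Uniqueness of generic representations -/

section Conjugacy

variable {𝔘 : Tuple} {U : Type w} [𝔘.lang.Structure U] {Γ : Type*} [Group Γ]

/-- The automorphism `h` restricts to an isomorphism from the restriction of `θ` to a finite
invariant set `A` to a restriction of `θ'`. -/
structure Rep.IsPartialConj (θ θ' : Rep 𝔘.lang U Γ) (h : Aut 𝔘.lang U) (A : Set U) : Prop where
  finite : A.Finite
  mapsTo : ∀ γ, Set.MapsTo (θ γ) A A
  conj : ∀ γ, ∀ a ∈ A, h (θ γ a) = θ' γ (h a)

lemma Rep.IsPartialConj.symm {θ θ' : Rep 𝔘.lang U Γ} {h : Aut 𝔘.lang U} {A : Set U}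
    (hA : θ.IsPartialConj θ' h A) : θ'.IsPartialConj θ h⁻¹ (h '' A) := by
  have hinv : ∀ u, h⁻¹ (h u) = u := fun u => h.toEquiv.symm_apply_apply u
  refine ⟨hA.finite.image h, ?_, ?_⟩
  · rintro γ _ ⟨a, ha, rfl⟩
    exact ⟨_, hA.mapsTo γ ha, hA.conj γ a ha⟩
  · rintro γ _ ⟨a, ha, rfl⟩
    rw [← hA.conj γ a ha, hinv, hinv]

variable [Countable U]

/-- The orbit of `u` is finite, so it can be added in one step. Transporting `θ` by `h` gives a
finite action that agrees with `θ'` on `h '' A`, and saturation of `θ'` realises it there. -/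
lemma Rep.IsPartialConj.exists_extension (hU : 𝔘.IsRandomisedUltrametricSpace U)
    {θ θ' : Rep 𝔘.lang U Γ} (hθ : θ.FiniteOrbits) (hθ' : θ'.Saturated) {h : Aut 𝔘.lang U}
    {A : Set U} (hA : θ.IsPartialConj θ' h A) (u : U) :
    ∃ (h' : Aut 𝔘.lang U) (A' : Set U), θ.IsPartialConj θ' h' A' ∧ A ⊆ A' ∧ u ∈ A' ∧
      ∀ a ∈ A, h' a = h a := by
  have hinv : ∀ v, h⁻¹ (h v) = v := fun v => h.toEquiv.symm_apply_apply v
  set A' : Set U := A ∪ θ.orbit u with hA'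
  have hfin : A'.Finite := hA.finite.union (hθ u)
  have hmaps : ∀ γ, Set.MapsTo (θ γ) A' A' := fun γ =>
    (hA.mapsTo γ).union_union (θ.mapsTo_orbit u γ)
  let η : Rep 𝔘.lang U Γ := (MulAut.conj h).toMonoidHom.comp θ
  have hη : ∀ γ v, η γ (h v) = h (θ γ v) := fun γ v =>
    congrArg (fun w => h (θ γ w)) (hinv v)
  have hηmaps : ∀ γ, Set.MapsTo (η γ) (h '' A') (h '' A') := by
    rintro γ _ ⟨a, ha, rfl⟩
    exact ⟨_, hmaps γ ha, (hη γ a).symm⟩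
  -- Applied with `X = U`, this only cuts `η` down to a partial representation; `e` fixes `h '' A'`
  -- pointwise.
  obtain ⟨B, β, e, hβ, -, heB, he, heβ⟩ := hU.exists_isPartialRep hU.isUStructure (hfin.image h)
    ((Aut.toPerm 𝔘.lang U).comp η) hηmaps (fun γ => 𝔘.isEmbOn_aut _ (η γ)) (hfin.image h)
    (j := id) (𝔘.isEmbOn_aut _ 1) (Set.mapsTo_id _)
  have he : ∀ a ∈ A', e (h a) = h a := fun a ha => he _ ⟨a, ha, rfl⟩
  have hB : ∀ a ∈ A', h a ∈ B := fun a ha => by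
    rw [← he a ha]
    exact heB ⟨a, ha, rfl⟩
  have hβ' : ∀ γ, ∀ a ∈ A', β γ (h a) = h (θ γ a) := by
    intro γ a ha
    have : e (η γ (h a)) = β γ (e (h a)) := heβ γ _ ⟨a, ha, rfl⟩
    rw [he a ha, hη, he _ (hmaps γ ha)] at this
    exact this.symm
  obtain ⟨g, hg, hgA, hgB⟩ := hθ' (h '' A) B β hβ
    (by rintro _ ⟨a, ha, rfl⟩; exact hB a (Or.inl ha))
    (by
      rintro γ _ ⟨a, ha, rfl⟩
      exact ⟨_, hA.mapsTo γ ha, (hβ' γ a (Or.inl ha)).symm⟩)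
    (by
      rintro γ _ ⟨a, ha, rfl⟩
      rw [hβ' γ a (Or.inl ha), hA.conj γ a ha])
  obtain ⟨k, hk⟩ := hU.exists_aut hfin (hg.comp (𝔘.isEmbOn_aut A' h) hB)
  refine ⟨k, A', ⟨hfin, hmaps, fun γ a ha => ?_⟩, Set.subset_union_left,
    Or.inr (θ.mem_orbit_self u), fun a ha => ?_⟩
  · rw [hk _ (hmaps γ ha), hk a ha]
    change g (h (θ γ a)) = θ' γ (g (h a))
    rw [hgB γ _ (hB a ha), hβ' γ a ha]
  · rw [hk a (Or.inl ha)]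
    exact hgA _ ⟨a, ha, rfl⟩

/-- Saturated representations with finite orbits are conjugate. -/
lemma Rep.isConjugate_of_saturated (hU : 𝔘.IsRandomisedUltrametricSpace U)
    {θ θ' : Rep 𝔘.lang U Γ} (hθ : θ.FiniteOrbits) (hθs : θ.Saturated) (hθ' : θ'.FiniteOrbits)
    (hθs' : θ'.Saturated) : θ.IsConjugate θ' := by
  obtain ⟨s, -, hs, hsU⟩ := exists_chain
    (σ := {p : Aut 𝔘.lang U × Set U // θ.IsPartialConj θ' p.1 p.2})
    (r := fun p q => p.1.2 ⊆ q.1.2 ∧ ∀ a ∈ p.1.2, q.1.1 a = p.1.1 a)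
    (p := fun u p => u ∈ p.1.2 ∧ u ∈ p.1.1 '' p.1.2)
    (fun p => ⟨subset_rfl, fun _ _ => rfl⟩)
    (fun p q v h h' => ⟨h.1.trans h'.1, fun a ha => (h'.2 a (h.1 ha)).trans (h.2 a ha)⟩)
    (fun p u => by
      obtain ⟨h₁, A₁, hA₁, hsub₁, hu₁, hag₁⟩ := p.2.exists_extension hU hθ hθs' u
      -- The back step: extending the inverse to `u` puts `u` into the image.
      obtain ⟨h₂, A₂, hA₂, hsub₂, hu₂, hag₂⟩ := hA₁.symm.exists_extension hU hθ' hθs u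
      have hinv : ∀ v, h₁⁻¹ (h₁ v) = v := fun v => h₁.toEquiv.symm_apply_apply v
      have hinv₂ : ∀ v, h₂⁻¹ (h₂ v) = v := fun v => h₂.toEquiv.symm_apply_apply v
      have e : ∀ a ∈ A₁, h₂ (h₁ a) = a := fun a ha => by
        rw [hag₂ _ ⟨a, ha, rfl⟩, hinv]
      have hmem : ∀ a ∈ A₁, a ∈ h₂ '' A₂ := fun a ha => ⟨h₁ a, hsub₂ ⟨a, ha, rfl⟩, e a ha⟩
      refine ⟨⟨(h₂⁻¹, h₂ '' A₂), hA₂.symm⟩, ⟨fun a ha => hmem a (hsub₁ ha), fun a ha => ?_⟩,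
        hmem u hu₁, ⟨h₂ u, ⟨u, hu₂, rfl⟩, hinv₂ u⟩⟩
      change h₂⁻¹ a = p.1.1 a
      conv_lhs => rw [← e a (hsub₁ ha)]
      rw [hinv₂, hag₁ a ha])
    ⟨(1, ∅), Set.finite_empty, fun _ => Set.mapsTo_empty _ _, by simp⟩
  obtain ⟨g, hg⟩ := exists_limit_aut (fun n => (s n).1.2) (fun m n hmn => (hs m n hmn).1)
    (fun u => (hsU u).imp fun _ h => h.1) (fun n => (s n).1.1) (fun m n hmn => (hs m n hmn).2)
    (fun u => (hsU u).imp fun _ h => h.2)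
  refine ⟨g, fun γ => ?_⟩
  rw [mul_inv_eq_iff_eq_mul]
  ext u
  obtain ⟨n, hn, -⟩ := hsU u
  change g (θ γ u) = θ' γ (g u)
  rw [hg n _ ((s n).2.mapsTo γ hn), hg n u hn, (s n).2.conj γ u hn]

end Conjugacy

lemma Rep.IsConjugate.finiteOrbits {𝔘 : Tuple} {U : Type w} [𝔘.lang.Structure U] {Γ : Type*}
    [Group Γ] {π θ : Rep 𝔘.lang U Γ} (h : π.IsConjugate θ) (hθ : θ.FiniteOrbits) :
    π.FiniteOrbits := by
  obtain ⟨g, hg⟩ := h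
  intro u
  refine Set.Finite.of_finite_image ((hθ (g u)).subset ?_) g.injective.injOn
  rintro _ ⟨_, ⟨γ, rfl⟩, rfl⟩
  refine ⟨γ, ?_⟩
  change θ γ (g u) = g (π γ u)
  rw [← hg γ]
  exact congrArg (fun v => g (π γ v)) (g.toEquiv.symm_apply_apply u)

end RandUltra


theorem mainTheorem1 {Γ : Type*} [CommGroup Γ] [Group.FG Γ]
    (𝔘 : RandUltra.Tuple) (U : Type*) [𝔘.lang.Structure U] [Countable U]
    (hU : 𝔘.IsRandomisedUltrametricSpace U) :
    (∃ π : RandUltra.Rep 𝔘.lang U Γ, π.IsGeneric) ∧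
      ∀ π : RandUltra.Rep 𝔘.lang U Γ, π.IsGeneric → ∀ u : U, (π.orbit u).Finite := by
  have : Countable Γ := RandUltra.countable_of_group_fg
  have : BaireSpace (RandUltra.Rep 𝔘.lang U Γ) := RandUltra.Rep.baireSpace
  have : Nonempty (RandUltra.Rep 𝔘.lang U Γ) := ⟨1⟩
  have hfin := RandUltra.Rep.finiteOrbits_mem_residual (Γ := Γ) hU
  have hsat := RandUltra.Rep.saturated_mem_residual (Γ := Γ) hU
  refine ⟨?_, fun π hπ => ?_⟩
  · obtain ⟨π, hπ, hπs⟩ := (dense_of_mem_residual (Filter.inter_mem hfin hsat)).nonempty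
    refine ⟨π, ?_⟩
    filter_upwards [hfin, hsat] with θ hθ hθs
    exact RandUltra.Rep.isConjugate_of_saturated hU hπ hπs hθ hθs
  -- Two comeagre sets in a non-empty Baire space meet, so `π` is conjugate to some `θ` with finite
  -- orbits.
  · obtain ⟨θ, hθ, hπθ⟩ := (dense_of_mem_residual (Filter.inter_mem hfin hπ)).nonempty
    exact RandUltra.Rep.IsConjugate.finiteOrbits hπθ hθ
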